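/- **Conventions.** Let $E,F$ be real Banach spaces and let $X,Y$ be connected regular Hausdorff $C^1$ manifolds modeled on $E$ and $F$, with Finsler structures in the sense of Palais: continuous families of norms $\|\cdot\|_x$ on the tangent spaces such that, for every chart $(W,\varphi)$ at $x_0$, the norm $\|d\varphi^{-1}(\varphi(x_0))(\cdot)\|_{x_0}$ is equivalent to the norm of $E$, and for every $\varepsilon>0$ the norms $\|d\varphi^{-1}(\varphi(x))(\cdot)\|_{x}$ and $\|d\varphi^{-1}(\varphi(x_0))(\cdot)\|_{x_0}$ agree up to the factor $1+\varepsilon$ for $x$ near $x_0$. Let $d_X,d_Y$ be the Finsler distances (infimum of the lengths of $C^1$ paths) and $B_X,B_Y$ their open balls. $Y$ has *smooth norm* if every $\|\cdot\|_y$, $y\in Y$, is Fréchet differentiable away from $0$. A map $f:X\to Y$ is *locally Lipschitz* if near each point it is Lipschitz in suitable charts. A nonempty set $J\subset\mathcal L(E,F)$ is a *pseudo-Jacobian* of a map $\mathbf f$ at $\mathbf u$ if $$\limsup_{t\to0^+}\frac{y^*(\mathbf f(\mathbf u+tv))-y^*(\mathbf f(\mathbf u))}{t}\le\sup_{T\in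 J}\,y^*(Tv)\qquad\text{for all } y^*\in F^*,\ v\in E.$$ A family $Jf$ of sets $Jf(x)\subset\mathcal L(T_xX,T_{f(x)}Y)$ $(x\in X)$ is a *strong pseudo-Jacobian mapping* of $f$ if for each $x$ there are charts $(W,\varphi)$ at $x$ and $(V,\psi)$ at $f(x)$ with $f(W)\subset V$, and a locally bounded set-valued map $J\mathbf f:\varphi(W)\to2^{\mathcal L(E,F)}$, such that for each $\mathbf u\in\varphi(W)$ the set $J\mathbf f(\mathbf u)$ is convex, compact in the weak operator topology, and a pseudo-Jacobian of $\mathbf f=\psi\circ f\circ\varphi^{-1}$ at $\mathbf u$, and $$Jf(u)=d\psi^{-1}(\psi(f(u)))\circ J\mathbf f(\varphi(u))\circ d\varphi(u)\qquad\text{for all }u\in W.$$ For $T\in\mathcal L(T_xX,T_{f(x)}Y)$ put $C(T)=\inf_{|y^*|=1}|T^*y^*|$ and $C^*(T)=\inf_{\|u\|=1}\|Tu\|$, with respect to the Finsler norms and their dual norms, and with values in $[0,\infty]$ ($\inf\emptyset=\infty$). For charts $\varphi$ at $x$ and $\psi$ at $f(x)$, and $R>0$, let $\mathrm{co}\,Jf(B_X(x;R))\subset\mathcal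 L(T_xX,T_{f(x)}Y)$ be the convex hull of the operators in $Jf(u)$, $u\in B_X(x;R)$, where operators between different tangent spaces are identified through $\varphi,\psi$, that is, when they have the same representative in $\mathcal L(E,F)$ (only $u$ in the domain of $\varphi$ with $f(u)$ in the domain of $\psi$ are taken, which is no restriction for small $R$). Put $$C(Jf(x))=\sup_{R>0}\inf\{C(T):T\in\mathrm{co}\,Jf(B_X(x;R))\},\qquad C^*(Jf(x))=\sup_{R>0}\inf\{C^*(T):T\in\mathrm{co}\,Jf(B_X(x;R))\}.$$ The map $f$ is *$Jf$-regular at $x$* if $C(Jf(x))>0$ and, for some $R>0$, every $T\in\mathrm{co}\,Jf(B_X(x;R))$ is a linear isomorphism. **Theorem 5.4 (Inverse Mapping Theorem).** Let $f:X\to Y$ be locally Lipschitz, let $Y$ have smooth norm, and let $Jf$ be a strong pseudo-Jacobian mapping of $f$. Let $x\in X$, and suppose that, for some choice of charts at $x$ and $f(x)$, the map $f$ is $Jf$-regular at $x$ and $C(Jf(x))>\alpha>0$. Then there is an open neighborhood $U$ of $x$ such that: 1. $f_x:=f|_U:U\to f(U)$ is a homeomorphism, and $d_Y(f(u),f(u'))\ge\alpha\,d_X(u,u')$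 for all $u,u'\in U$. 2. $f_x$ is an open map into $Y$, with linear rate at every $u\in U$: there are a neighborhood $W\subset U$ of $u$ and $\beta>0$ such that $B_Y(f(w);\beta r)\subset f(B_X(w;r))$ whenever $w\in W$, $r>0$ and $B_X(w;r)\subset W$. Moreover, for every $u\in U$, and whatever charts at $u$ and $f(u)$ are used, $C^*(Jf(u))=C(Jf(u))\ge\alpha$. 3. $f_x^{-1}:f(U)\to X$ is Lipschitz continuous, and $\mathrm{lip}\,f_x^{-1}(f(u))\le\alpha^{-1}$ for all $u\in U$, where $\mathrm{lip}\,g(y)$ is the infimum over $R>0$ of $\sup\{d_X(g(z),g(z'))/d_Y(z,z') : z\ne z'\text{ in }f(U)\cap B_Y(y;R)\}$. -/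

import Mathlib

open Set Filter Topology
open scoped Manifold ENNReal ContDiff

noncomputable section

section BanachSpaces

variable {E F : Type*} [NormedAddCommGroup E] [NormedSpace ℝ E]
  [NormedAddCommGroup F] [NormedSpace ℝ F]

/-- The nonempty set `J` of bounded operators is a pseudo-Jacobian of `f` at `x`: for all `y*` and
`v`, the upper right-hand Dini derivative of `y* ∘ f` at `x` in the direction `v` is at most
`sup {⟨y*, T v⟩ : T ∈ J}` (both sides are taken in `[-∞, ∞]`). -/
def IsPseudoJacobianAt (f : E → F) (x : E) (J : Set (E →L[ℝ] F)) : Prop :=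
  J.Nonempty ∧ ∀ (y : F →L[ℝ] ℝ) (v : E),
    limsup (fun t : ℝ => (((y (f (x + t • v)) - y (f x)) / t : ℝ) : EReal)) (𝓝[>] 0) ≤
      ⨆ T ∈ J, ((y (T v) : ℝ) : EReal)

/-- A set-valued map `J` into the bounded operators is locally bounded on the set `U`. -/
def IsLocallyBoundedOn (J : E → Set (E →L[ℝ] F)) (U : Set E) : Prop :=
  ∀ x ∈ U, ∃ R > 0, Metric.ball x R ⊆ U ∧ Bornology.IsBounded (⋃ z ∈ Metric.ball x R, J z)

/-- Compactness of a set of bounded operators in the weak operator topology. -/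
def IsWOTCompact (J : Set (E →L[ℝ] F)) : Prop :=
  IsCompact {A : E →WOT[ℝ] F | A.toCLM ∈ J}

end BanachSpaces

section BanachConstants

/-! Here `V` and `V'` stand for tangent spaces, with norms `p` and `q`. All suprema and infima are
taken in `[0, ∞]`; in particular the infimum over an empty unit sphere is `∞`. -/

variable {V V' : Type*} [AddCommGroup V] [Module ℝ V] [TopologicalSpace V]
  [AddCommGroup V'] [Module ℝ V'] [TopologicalSpace V']

/-- The dual norm of a continuous functional with respect to the norm `p`. -/
def dualNorm (p : Seminorm ℝ V) (y : V →L[ℝ] ℝ) : ℝ≥0∞ :=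
  ⨆ (v : V) (_ : p v ≤ 1), ENNReal.ofReal |y v|

/-- The Banach constant `C(T) = inf {|T* y*| : |y*| = 1}`. -/
def banachConstant (p : Seminorm ℝ V) (q : Seminorm ℝ V') (T : V →L[ℝ] V') : ℝ≥0∞ :=
  ⨅ (y : V' →L[ℝ] ℝ) (_ : dualNorm q y = 1), dualNorm p (y ∘L T)

/-- The dual Banach constant `C*(T) = inf {‖T u‖ : ‖u‖ = 1}`. -/
def dualBanachConstant (p : Seminorm ℝ V) (q : Seminorm ℝ V') (T : V →L[ℝ] V') : ℝ≥0∞ :=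
  ⨅ (u : V) (_ : p u = 1), ENNReal.ofReal (q (T u))

end BanachConstants

section Charts

variable {E : Type*} [NormedAddCommGroup E] [NormedSpace ℝ E]
  {X : Type*} [TopologicalSpace X] [ChartedSpace E X]

/-- `φ` is a chart of the `C^1` manifold `X` at `x`: a member of the maximal `C^1` atlas whose
domain contains `x`. -/
def IsChartAt (φ : OpenPartialHomeomorph X E) (x : X) : Prop :=
  φ ∈ IsManifold.maximalAtlas 𝓘(ℝ, E) 1 X ∧ x ∈ φ.source

/-- The differential `dφ(x) : T_x X → E` of a chart. -/
def chartDeriv (φ : OpenPartialHomeomorph X E) (x : X) : TangentSpace 𝓘(ℝ, E) x →L[ℝ] E :=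
  mfderiv 𝓘(ℝ, E) 𝓘(ℝ, E) φ x

/-- The differential `dφ⁻¹(φ(x)) : E → T_x X` of the inverse of a chart at `x`. -/
def chartDerivSymm (φ : OpenPartialHomeomorph X E) (x : X) : E →L[ℝ] TangentSpace 𝓘(ℝ, E) x :=
  mfderiv 𝓘(ℝ, E) 𝓘(ℝ, E) φ.symm (φ x)

variable (E X) in
/-- A Finsler structure (in the sense of Palais) on the tangent bundle of a `C^1` manifold. -/
structure FinslerStructure [IsManifold 𝓘(ℝ, E) 1 X] where
  /-- the norm on each tangent space -/
  norm : ∀ x : X, Seminorm ℝ (TangentSpace 𝓘(ℝ, E) x)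
  continuous_norm : Continuous fun p : TangentBundle 𝓘(ℝ, E) X => norm p.proj p.snd
  equivalent : ∀ (x : X) (φ : OpenPartialHomeomorph X E), IsChartAt φ x →
    ∃ m > 0, ∃ M > 0, ∀ v : E,
      m * ‖v‖ ≤ norm x (chartDerivSymm φ x v) ∧ norm x (chartDerivSymm φ x v) ≤ M * ‖v‖
  locally_close : ∀ (x₀ : X) (φ : OpenPartialHomeomorph X E), IsChartAt φ x₀ → ∀ ε > 0,
    ∃ U : Set X, IsOpen U ∧ x₀ ∈ U ∧ U ⊆ φ.source ∧ ∀ x ∈ U, ∀ v : E,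
      1 / (1 + ε) * norm x₀ (chartDerivSymm φ x₀ v) ≤ norm x (chartDerivSymm φ x v) ∧
      norm x (chartDerivSymm φ x v) ≤ (1 + ε) * norm x₀ (chartDerivSymm φ x₀ v)

namespace FinslerStructure

variable [IsManifold 𝓘(ℝ, E) 1 X]

/-- The Finsler distance with values in `[0, ∞]`: the infimum of `∫ ‖σ'(t)‖_{σ(t)} dt` over the
`C^1` paths `σ : [0, 1] → X` from `x` to `y`. (Mathlib's `riemannianEDist` makes sense for an
arbitrary family of norms on the tangent spaces.) -/
def edist (N : FinslerStructure E X) (x y : X) : ℝ≥0∞ :=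
  letI : ∀ z : X, ENorm (TangentSpace 𝓘(ℝ, E) z) :=
    fun z => ⟨fun v => ENNReal.ofReal (N.norm z v)⟩
  Manifold.riemannianEDist 𝓘(ℝ, E) x y

/-- The Finsler distance `d_X`, a real number when `X` is connected. -/
def dist (N : FinslerStructure E X) (x y : X) : ℝ := (N.edist x y).toReal

/-- The open ball `B_X(x; r)` of the Finsler distance. -/
def ball (N : FinslerStructure E X) (x : X) (r : ℝ) : Set X := {u | N.dist u x < r}

/-- Every norm `‖·‖_x` is Fréchet differentiable away from `0`. -/
def HasSmoothNorm (N : FinslerStructure E X) : Prop :=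
  ∀ (x : X) (v : E), v ≠ 0 →
    DifferentiableAt ℝ (fun w : E => N.norm x (show TangentSpace 𝓘(ℝ, E) x from w)) v

end FinslerStructure

end Charts

section Maps

variable {E F : Type*} [NormedAddCommGroup E] [NormedSpace ℝ E]
  [NormedAddCommGroup F] [NormedSpace ℝ F]
  {X : Type*} [TopologicalSpace X] [ChartedSpace E X]
  {Y : Type*} [TopologicalSpace Y] [ChartedSpace F Y]

/-- `f` is locally Lipschitz: at each point it is Lipschitz in suitable charts. -/
def IsLocallyLipschitz (f : X → Y) : Prop :=
  ∀ x : X, ∃ (φ : OpenPartialHomeomorph X E) (ψ : OpenPartialHomeomorph Y F) (K : NNReal),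
    IsChartAt φ x ∧ IsChartAt ψ (f x) ∧ MapsTo f φ.source ψ.source ∧
      LipschitzOnWith K (ψ ∘ f ∘ φ.symm) φ.target

/-- A family `Jf(x)` of sets of operators from `T_x X` to `T_{f(x)} Y`. -/
abbrev OperatorFamily (E F : Type*) [NormedAddCommGroup E] [NormedSpace ℝ E]
    [NormedAddCommGroup F] [NormedSpace ℝ F] {X : Type*} [TopologicalSpace X] [ChartedSpace E X]
    {Y : Type*} [TopologicalSpace Y] [ChartedSpace F Y] (f : X → Y) :=
  ∀ x : X, Set (TangentSpace 𝓘(ℝ, E) x →L[ℝ] TangentSpace 𝓘(ℝ, F) (f x))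

/-- In the charts `φ`, `ψ` (with `f(W) ⊆ V` for their domains `W`, `V`), the family `Jf` is given
by the locally bounded pseudo-Jacobian mapping `𝐉` of `𝐟 = ψ ∘ f ∘ φ⁻¹` on `φ(W)`:
`Jf(u) = dψ⁻¹(ψ(f(u))) ∘ 𝐉(φ(u)) ∘ dφ(u)` for `u ∈ W`. -/
def IsRepresentedBy (f : X → Y) (Jf : OperatorFamily E F f) (φ : OpenPartialHomeomorph X E)
    (ψ : OpenPartialHomeomorph Y F) (J : E → Set (E →L[ℝ] F)) : Prop :=
  MapsTo f φ.source ψ.source ∧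
  (∀ z ∈ φ.target, IsPseudoJacobianAt (ψ ∘ f ∘ φ.symm) z (J z)) ∧
  IsLocallyBoundedOn J φ.target ∧
  ∀ u ∈ φ.source,
    Jf u = (fun T : E →L[ℝ] F => chartDerivSymm ψ (f u) ∘L T ∘L chartDeriv φ u) '' J (φ u)

/-- `Jf` is a pseudo-Jacobian mapping for `f`. -/
def IsPseudoJacobianMapping (f : X → Y) (Jf : OperatorFamily E F f) : Prop :=
  ∀ x : X, ∃ (φ : OpenPartialHomeomorph X E) (ψ : OpenPartialHomeomorph Y F)
    (J : E → Set (E →L[ℝ] F)), IsChartAt φ x ∧ IsChartAt ψ (f x) ∧ IsRepresentedBy f Jf φ ψ J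

/-- `Jf` is a strong pseudo-Jacobian mapping for `f`: the sets of operators in the charts are
moreover convex and compact in the weak operator topology. -/
def IsStrongPseudoJacobianMapping (f : X → Y) (Jf : OperatorFamily E F f) : Prop :=
  ∀ x : X, ∃ (φ : OpenPartialHomeomorph X E) (ψ : OpenPartialHomeomorph Y F)
    (J : E → Set (E →L[ℝ] F)), IsChartAt φ x ∧ IsChartAt ψ (f x) ∧ IsRepresentedBy f Jf φ ψ J ∧
      ∀ z ∈ φ.target, Convex ℝ (J z) ∧ IsWOTCompact (J z)

/-- An operator `T : T_u X → T_{f(u)} Y` carried to an operator `T_x X → T_{f(x)} Y` by means of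
the charts `φ` and `ψ`: both have the same representative in `𝓛(E, F)`. -/
def transportOperator (f : X → Y) (φ : OpenPartialHomeomorph X E)
    (ψ : OpenPartialHomeomorph Y F) (x u : X)
    (T : TangentSpace 𝓘(ℝ, E) u →L[ℝ] TangentSpace 𝓘(ℝ, F) (f u)) :
    TangentSpace 𝓘(ℝ, E) x →L[ℝ] TangentSpace 𝓘(ℝ, F) (f x) :=
  chartDerivSymm ψ (f x) ∘L (chartDeriv ψ (f u) ∘L T ∘L chartDerivSymm φ u) ∘L chartDeriv φ x

variable [IsManifold 𝓘(ℝ, E) 1 X] [IsManifold 𝓘(ℝ, F) 1 Y]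

/-- The set `co Jf(B_X(x; R))` of operators from `T_x X` to `T_{f(x)} Y`. The operators in `Jf(u)`,
`u ∈ B_X(x; R)`, live between different tangent spaces; they are compared through the charts `φ` at
`x` and `ψ` at `f(x)`. Only points `u` in the range of the charts contribute, which is all of
`B_X(x; R)` when `R` is small. -/
def coJacobian (N : FinslerStructure E X) (f : X → Y) (Jf : OperatorFamily E F f)
    (φ : OpenPartialHomeomorph X E) (ψ : OpenPartialHomeomorph Y F) (x : X) (R : ℝ) :
    Set (TangentSpace 𝓘(ℝ, E) x →L[ℝ] TangentSpace 𝓘(ℝ, F) (f x)) :=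
  convexHull ℝ {S | ∃ u ∈ N.ball x R, u ∈ φ.source ∧ f u ∈ ψ.source ∧
    ∃ T ∈ Jf u, S = transportOperator f φ ψ x u T}

/-- The Finsler regularity index
`C(Jf(x)) = sup_{R > 0} inf {C(T) : T ∈ co Jf(B_X(x; R))}`, computed in the charts `φ`, `ψ`. -/
def regularityIndex (N : FinslerStructure E X) (N' : FinslerStructure F Y) (f : X → Y)
    (Jf : OperatorFamily E F f) (φ : OpenPartialHomeomorph X E) (ψ : OpenPartialHomeomorph Y F)
    (x : X) : ℝ≥0∞ :=
  ⨆ (R : ℝ) (_ : 0 < R), ⨅ T ∈ coJacobian N f Jf φ ψ x R,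
    banachConstant (N.norm x) (N'.norm (f x)) T

/-- The Finsler local-injectivity index
`C*(Jf(x)) = sup_{R > 0} inf {C*(T) : T ∈ co Jf(B_X(x; R))}`, computed in the charts `φ`, `ψ`. -/
def injectivityIndex (N : FinslerStructure E X) (N' : FinslerStructure F Y) (f : X → Y)
    (Jf : OperatorFamily E F f) (φ : OpenPartialHomeomorph X E) (ψ : OpenPartialHomeomorph Y F)
    (x : X) : ℝ≥0∞ :=
  ⨆ (R : ℝ) (_ : 0 < R), ⨅ T ∈ coJacobian N f Jf φ ψ x R,
    dualBanachConstant (N.norm x) (N'.norm (f x)) T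

/-- `f` is `Jf`-regular at `x`: `C(Jf(x)) > 0`, and for some `R > 0` every operator in
`co Jf(B_X(x; R))` is a linear isomorphism. -/
def IsJacobianRegularAt (N : FinslerStructure E X) (N' : FinslerStructure F Y) (f : X → Y)
    (Jf : OperatorFamily E F f) (φ : OpenPartialHomeomorph X E) (ψ : OpenPartialHomeomorph Y F)
    (x : X) : Prop :=
  0 < regularityIndex N N' f Jf φ ψ x ∧
    ∃ R > 0, ∀ T ∈ coJacobian N f Jf φ ψ x R, Function.Bijective T

/-- The restriction of `f` to the open set `U` is open with linear rate around `u`: there are a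
neighborhood `W ⊆ U` of `u` and `β > 0` such that `B_Y(f(w); β r) ⊆ f(B_X(w; r))` whenever `w ∈ W`
and `B_X(w; r) ⊆ W`. -/
def IsOpenWithLinearRateAt (N : FinslerStructure E X) (N' : FinslerStructure F Y) (f : X → Y)
    (U : Set X) (u : X) : Prop :=
  ∃ W ∈ 𝓝 u, W ⊆ U ∧ ∃ β > 0, ∀ w ∈ W, ∀ r > 0, N.ball w r ⊆ W →
    N'.ball (f w) (β * r) ⊆ f '' N.ball w r

/-- The local Lipschitz constant at `y` of a map `g : S → X` defined on a subset `S` of `Y`: the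
infimum over `R > 0` of the Lipschitz constants of `g` on `B_Y(y; R) ∩ S`, in `[0, ∞]`. -/
def lipRate (N : FinslerStructure E X) (N' : FinslerStructure F Y) {S : Set Y} (g : S → X)
    (y : Y) : ℝ≥0∞ :=
  ⨅ (R : ℝ) (_ : 0 < R), ⨆ (z : S) (z' : S)
    (_ : (z : Y) ∈ N'.ball y R ∧ (z' : Y) ∈ N'.ball y R ∧ z ≠ z'),
    ENNReal.ofReal (N.dist (g z) (g z') / N'.dist z z')

end Maps

end

/-! Read in charts, `f` becomes a Lipschitz map `f₀` between open sets of Banach spaces. For an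
isomorphism the two Banach constants agree (`banachConstant_eq_dualBanachConstant`), and
isomorphisms expanding by a given factor are stable under small perturbations
(`bijective_and_forall_le_of_norm_sub_le`). Hence regularity at `x`, in whatever charts, says that
the convex hull of the operators near `x` in the representing charts consists of isomorphisms
expanding by some `κ > α` (`IsJacobianRegularAt.exists_localHull`). Two facts about `f₀` follow.

Expansion: if `f₀ b - f₀ a` were too short, Hahn–Banach would separate it from the convex set of all
`T (b - a)`, against a scalar mean value inequality (`le_seminorm_sub_of_isPseudoJacobianAt`).

Openness: to solve `f₀ u = w`, take an Ekeland almost-minimizer `u` of `q (f₀ u - w)`. If `f₀ u ≠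
w`, the smooth norm `q` has a derivative `ℓ` at `f₀ u - w`, and almost-minimality together with a
minimax argument on the weakly compact convex set `J u` produces `T ∈ J u` with `ℓ ∘ T` small. As
`T` is onto and expanding, this is impossible (`exists_ball_subset_image`).

Finally the Finsler distance agrees with the distance in a chart up to a factor `k` as close to 1 as
desired (`FinslerStructure.exists_dist_comparison`); with `α k² < κ`, expansion in charts becomes
expansion by `α` on the manifolds. The linear rate and the Lipschitz inverse are consequences of
expansion and openness. -/

noncomputable section

/-! ### Ekeland's variational principle -/

/-- The weak form of Ekeland's variational principle. -/
theorem exists_ekeland_point {X : Type*} [MetricSpace X] [CompleteSpace X] {g : X → ℝ}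
    (hg : Continuous g) (hg0 : ∀ x, 0 ≤ g x) {ε : ℝ} (hε : 0 < ε) (x₀ : X) :
    ∃ x, g x + ε * dist x₀ x ≤ g x₀ ∧ ∀ y, g x ≤ g y + ε * dist x y := by
  let S : X → Set X := fun x => {y | g y + ε * dist x y ≤ g x}
  have hSself : ∀ x, x ∈ S x := fun x => by simp [S]
  have hStrans : ∀ x y z, y ∈ S x → z ∈ S y → z ∈ S x := by
    intro x y z hy hz
    simp only [S, mem_ofPred_eq] at *
    have := mul_le_mul_of_nonneg_left (dist_triangle x y z) hε.le
    linarith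
  have hbdd : ∀ x, BddBelow (g '' S x) := fun x => ⟨0, by rintro _ ⟨y, -, rfl⟩; exact hg0 y⟩
  have hstep : ∀ (n : ℕ) (x : X), ∃ y ∈ S x, g y < sInf (g '' S x) + (1 / 2) ^ n := by
    intro n x
    obtain ⟨_, ⟨y, hy, rfl⟩, h⟩ := exists_lt_of_csInf_lt (s := g '' S x)
      ⟨_, mem_image_of_mem g (hSself x)⟩
      (lt_add_of_pos_right (sInf (g '' S x)) (pow_pos (by norm_num : (0 : ℝ) < 1 / 2) n))
    exact ⟨y, hy, h⟩
  choose next hnext hnext' using hstep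
  let u : ℕ → X := fun n => Nat.rec x₀ (fun k y => next k y) n
  have hu : ∀ n, u (n + 1) = next n (u n) := fun n => rfl
  have hmem : ∀ n m, n ≤ m → u m ∈ S (u n) := by
    intro n m hnm
    induction m, hnm using Nat.le_induction with
    | base => exact hSself _
    | succ k _ ih => exact hStrans _ _ _ ih (hu k ▸ hnext k (u k))
  have hanti : Antitone (g ∘ u) := antitone_nat_of_succ_le fun n => by
    have := hmem n (n + 1) n.le_succ
    simp only [S, mem_ofPred_eq] at this
    have h2 := mul_nonneg hε.le (dist_nonneg (x := u n) (y := u (n + 1)))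
    simp only [Function.comp_apply]
    linarith
  have hconv : Tendsto (g ∘ u) atTop (𝓝 (⨅ n, (g ∘ u) n)) :=
    tendsto_atTop_ciInf hanti ⟨0, by rintro _ ⟨n, rfl⟩; exact hg0 _⟩
  set l := ⨅ n, (g ∘ u) n
  have hl : ∀ n, l ≤ g (u n) := fun n => hanti.le_of_tendsto hconv n
  have hcauchy : CauchySeq u := by
    refine cauchySeq_of_le_tendsto_0 (fun n => (2 / ε) * (g (u n) - l)) ?_ ?_
    · intro n m N hn hm
      have h1 := hmem N n hn
      have h2 := hmem N m hm
      simp only [S, mem_ofPred_eq] at h1 h2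
      have h3 : ε * dist (u n) (u m) ≤ 2 * (g (u N) - l) := by
        have := mul_le_mul_of_nonneg_left (dist_triangle_left (u n) (u m) (u N)) hε.le
        have := hl n
        have := hl m
        linarith
      rw [div_mul_eq_mul_div, le_div_iff₀ hε]
      linarith
    · have := (hconv.sub_const l).const_mul (2 / ε)
      simpa using this
  obtain ⟨x, hx⟩ := cauchySeq_tendsto_of_complete hcauchy
  have hgx : g x = l := tendsto_nhds_unique ((hg.tendsto x).comp hx) hconv
  have hxS : ∀ n, x ∈ S (u n) := by
    intro n
    have hcl : IsClosed (S (u n)) := isClosed_le (by fun_prop) continuous_const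
    exact hcl.mem_of_tendsto hx (eventually_atTop.2 ⟨n, fun m hm => hmem n m hm⟩)
  refine ⟨x, hxS 0, fun y => ?_⟩
  by_contra! hlt
  have hy : y ∈ S x := hlt.le
  -- Since `y ∈ S x ⊆ S (u n)`, the near-minimality of `u (n + 1)` bounds `g y` from below; in the
  -- limit `g y ≥ l = g x`.
  have h1 : ∀ n, g (u (n + 1)) - (1 / 2) ^ n ≤ g y := fun n => by
    have h2 := csInf_le (hbdd (u n)) (mem_image_of_mem g (hStrans _ _ _ (hxS n) hy))
    have h3 := hnext' n (u n)
    rw [hu]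
    linarith
  have h2 : l ≤ g y := by
    have h3 : Tendsto (fun n => g (u (n + 1)) - (1 / 2 : ℝ) ^ n) atTop (𝓝 (l - 0)) :=
      ((tendsto_add_atTop_iff_nat 1).2 hconv).sub
        (tendsto_pow_atTop_nhds_zero_of_lt_one (by norm_num) (by norm_num))
    simpa using le_of_tendsto' h3 h1
  have h3 := mul_nonneg hε.le (dist_nonneg (x := x) (y := y))
  linarith

/-! ### Pseudo-Jacobians in Banach spaces: surjectivity and mean value inequalities -/

section BanachSpaces

variable {E F : Type*} [NormedAddCommGroup E] [NormedSpace ℝ E]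
  [NormedAddCommGroup F] [NormedSpace ℝ F]

/-- A minimax argument. If no `T` worked, each would have its own unit-ball vector `v` with `-y (T
v) > ε`. By compactness finitely many vectors serve all of `J`, and Sion's theorem, applied to a
pairing affine in each variable, merges them into a single `v₀`; this `v₀` violates `h`. -/
theorem exists_norm_comp_le_of_isWOTCompact {J : Set (E →L[ℝ] F)} (hne : J.Nonempty)
    (hconv : Convex ℝ J) (hcomp : IsWOTCompact J) (y : F →L[ℝ] ℝ) {ε : ℝ} (hε : 0 ≤ ε)
    (h : ∀ v : E, ∀ r : ℝ, r < -(ε * ‖v‖) → (r : EReal) ≤ ⨆ T ∈ J, ((y (T v) : ℝ) : EReal)) :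
    ∃ T ∈ J, ‖y ∘L T‖ ≤ ε := by
  by_contra! hcon
  set K : Set (E →WOT[ℝ] F) := {A | A.toCLM ∈ J} with hK
  have hKne : K.Nonempty := by
    obtain ⟨T, hT⟩ := hne
    exact ⟨.ofCLM T, hT⟩
  have hKconv : Convex ℝ K := fun A hA B hB a b ha hb hab => hconv hA hB ha hb hab
  have hc : ∀ v : E, Continuous fun A : E →WOT[ℝ] F => -y (A v) := fun v =>
    (ContinuousLinearMapWOT.continuous_dual_apply v y).neg
  have hpt : ∀ A ∈ K, ∃ v ∈ Metric.closedBall (0 : E) 1, ε < -y (A v) := by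
    intro A hA
    have h1 := hcon _ hA
    by_contra! h2
    refine h1.not_ge (ContinuousLinearMap.opNorm_le_of_unit_norm hε fun v hv => ?_)
    have h3 := h2 v (by simp [hv])
    have h4 := h2 (-v) (by simp [hv])
    simp only [map_neg, neg_neg] at h4
    exact abs_le.2 ⟨by simpa using neg_le_of_neg_le h3, h4⟩
  choose! v hvball hv using hpt
  obtain ⟨s, hscov⟩ := hcomp.elim_nhds_subcover' (fun A _ => {B | ε < -y (B (v A))})
    (fun A hA => (isOpen_lt continuous_const (hc _)).mem_nhds (hv A hA))
  obtain ⟨v₀, hv₀, hlt⟩ := Sion.exists_lt_iInf_of_lt_iInf_of_finite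
    (X := K) (Y := Metric.closedBall (0 : E) 1) (f := fun A v => -y (A v)) hKne hcomp
    (fun w _ => (hc w).lowerSemicontinuous.lowerSemicontinuousOn _)
    (fun w _ => by
      refine ConvexOn.quasiconvexOn ⟨hKconv, fun A _ B _ a b _ _ _ => le_of_eq ?_⟩
      simp; ring)
    (convex_closedBall _ _)
    (fun A _ => by
      refine Continuous.upperSemicontinuous ?_ |>.upperSemicontinuousOn _
      exact (y.continuous.comp A.toCLM.continuous).neg)
    (fun A _ => by
      refine ConcaveOn.quasiconcaveOn ⟨convex_closedBall _ _, fun w _ z _ a b _ _ _ =>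
        le_of_eq ?_⟩
      simp; ring)
    hKconv (s := (fun A : K => v A) '' s) (s.finite_toSet.image _)
    (by rintro _ ⟨A, -, rfl⟩; exact hvball _ A.2) (t := ε) (by
      intro A hA
      have hA' := hscov hA
      simp only [mem_iUnion] at hA'
      obtain ⟨B, hB, hAB⟩ := hA'
      exact ⟨_, ⟨B, hB, rfl⟩, hAB⟩)
  -- The supremum over `J` is attained, so the strict inequality for each operator survives the
  -- passage to the supremum.
  obtain ⟨A, hA, hmax⟩ := hcomp.exists_isMinOn hKne (hc v₀).continuousOn
  have hA' := hlt A hA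
  obtain ⟨r, hr1, hr2⟩ := exists_between (show y (A v₀) < -ε by linarith)
  have hnorm : ‖v₀‖ ≤ 1 := by simpa using hv₀
  have h1 := h v₀ r (by nlinarith)
  have h2 : (⨆ T ∈ J, ((y (T v₀) : ℝ) : EReal)) ≤ ((y (A v₀) : ℝ) : EReal) := by
    refine iSup₂_le fun T hT => ?_
    have h3 : -y (A v₀) ≤ -y ((ContinuousLinearMapWOT.ofCLM T : E →WOT[ℝ] F) v₀) := hmax hT
    simp only [ContinuousLinearMapWOT.ofCLM_apply] at h3
    exact_mod_cast neg_le_neg_iff.1 h3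
  exact absurd (EReal.coe_le_coe_iff.1 (h1.trans h2)) (not_le.2 hr1)

/-- First-order condition at an Ekeland point: almost-minimality bounds the increments of `q (f · -
w)` below by `-ε t ‖v‖`, and these differ from the increments of `ℓ ∘ f` by `o(t)` because `f` is
Lipschitz. The strictness of `r < -(ε * ‖v‖)` absorbs this error. -/
theorem neg_le_iSup_of_isPseudoJacobianAt {f : E → F} {a : E} {J : Set (E →L[ℝ] F)}
    (hJ : IsPseudoJacobianAt f a J) {q : F → ℝ} {w : F} {ℓ : F →L[ℝ] ℝ}
    (hq : HasFDerivAt q ℓ (f a - w)) {L : NNReal} {s : Set E} (hs : s ∈ 𝓝 a)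
    (hL : LipschitzOnWith L f s) {ε : ℝ}
    (hmin : ∀ u ∈ s, q (f a - w) ≤ q (f u - w) + ε * ‖u - a‖)
    (v : E) (r : ℝ) (hr : r < -(ε * ‖v‖)) :
    (r : EReal) ≤ ⨆ T ∈ J, ((ℓ (T v) : ℝ) : EReal) := by
  refine le_trans ?_ (hJ.2 ℓ v)
  refine le_limsup_of_frequently_le (Eventually.frequently ?_) (by isBoundedDefault)
  have hη : 0 < (-(ε * ‖v‖) - r) / (L * ‖v‖ + 1) := by
    apply div_pos (by linarith); positivity
  have htend : Tendsto (fun t : ℝ => a + t • v) (𝓝[>] 0) (𝓝 a) := by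
    have : Continuous fun t : ℝ => a + t • v := by fun_prop
    simpa using (this.tendsto 0).mono_left nhdsWithin_le_nhds
  have hfa : ContinuousAt f a := hL.continuousOn.continuousAt hs
  have h1 := (hfa.tendsto.comp htend).sub_const w |>.eventually (hq.isLittleO.def hη)
  filter_upwards [h1, htend hs, self_mem_nhdsWithin] with t ht hts ht0
  simp only [Function.comp_apply] at ht
  have ht0 : 0 < t := ht0
  have h2 := hmin _ hts
  have h3 := hL.norm_sub_le hts (mem_of_mem_nhds hs)
  simp only [add_sub_cancel_left, norm_smul, Real.norm_eq_abs, abs_of_pos ht0] at h2 h3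
  have h4 : f (a + t • v) - w - (f a - w) = f (a + t • v) - f a := by abel
  rw [h4, map_sub, Real.norm_eq_abs] at ht
  have h5 := (abs_le.1 ht).2
  have h6 : (-(ε * ‖v‖) - r) / (L * ‖v‖ + 1) * ‖f (a + t • v) - f a‖ ≤ (-(ε * ‖v‖) - r) * t := by
    calc _ ≤ (-(ε * ‖v‖) - r) / (L * ‖v‖ + 1) * ((L * ‖v‖ + 1) * t) := by
          gcongr; nlinarith
      _ = _ := by
          have : (L : ℝ) * ‖v‖ + 1 ≠ 0 := by positivity
          field_simp
  have h7 : r ≤ (ℓ (f (a + t • v)) - ℓ (f a)) / t := by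
    rw [le_div_iff₀ ht0]; nlinarith
  exact_mod_cast h7

/-- Local surjectivity of a Lipschitz map all of whose pseudo-Jacobians consist of operators with a
uniformly bounded inverse. -/
theorem exists_ball_subset_image [CompleteSpace E] {f : E → F} {J : E → Set (E →L[ℝ] F)} {a : E}
    {R : ℝ} (hR : 0 < R) {L : NNReal} (hL : LipschitzOnWith L f (Metric.closedBall a R))
    (hJ : ∀ z ∈ Metric.ball a R,
      IsPseudoJacobianAt f z (J z) ∧ Convex ℝ (J z) ∧ IsWOTCompact (J z))
    {c : ℝ} (hc : 0 < c)
    (hinv : ∀ z ∈ Metric.ball a R, ∀ T ∈ J z, Function.Surjective T ∧ ∀ v, c * ‖v‖ ≤ ‖T v‖)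
    (q : Seminorm ℝ F) {m M : ℝ} (hm : 0 < m) (hM : 0 < M) (hmq : ∀ w, m * ‖w‖ ≤ q w)
    (hqM : ∀ w, q w ≤ M * ‖w‖) (hsm : ∀ w, w ≠ 0 → DifferentiableAt ℝ q w) :
    ∃ δ > 0, Metric.ball (f a) δ ⊆ f '' Metric.ball a R := by
  -- Any `ε < c m` yields the final contradiction: `q (f u - w) ≥ m c ‖v‖` whenever `T v = f u - w`.
  set ε := c * m / 2 with hεdef
  have hε : 0 < ε := by positivity
  -- With this radius the starting value `q (f a - w)` is below `ε R`, which keeps the Ekeland point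
  -- strictly inside the ball.
  refine ⟨ε * R / M, by positivity, fun w hw => ?_⟩
  have hqcont : Continuous q := Seminorm.continuous_of_le (q := M.toNNReal • normSeminorm ℝ F)
    (by
      refine Continuous.congr (f := fun w : F => (M.toNNReal : ℝ) * ‖w‖) (by fun_prop) fun w => ?_
      rfl)
    fun w => by
      refine (hqM w).trans (le_of_eq ?_)
      change M * ‖w‖ = (M.toNNReal : ℝ) * ‖w‖
      rw [Real.coe_toNNReal _ hM.le]
  have : CompleteSpace (Metric.closedBall a R) :=
    Metric.isClosed_closedBall.completeSpace_coe
  have hg : Continuous fun u : Metric.closedBall a R => q (f u - w) :=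
    hqcont.comp ((hL.continuousOn.domRestrict).sub continuous_const)
  obtain ⟨⟨u, hu⟩, hu1, hu2⟩ := exists_ekeland_point hg (fun _ => apply_nonneg q _) hε
    ⟨a, Metric.mem_closedBall_self hR.le⟩
  simp only [Subtype.forall, Subtype.dist_eq] at hu1 hu2
  have huball : u ∈ Metric.ball a R := by
    have h1 : q (f a - w) < ε * R := by
      refine (hqM _).trans_lt ?_
      rw [mem_ball_iff_norm', lt_div_iff₀ hM] at hw
      linarith
    have h2 := apply_nonneg q (f u - w)
    rw [Metric.mem_ball']
    exact lt_of_mul_lt_mul_left (by linarith) hε.le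
  refine ⟨u, huball, ?_⟩
  by_contra hne
  have hw0 : f u - w ≠ 0 := sub_ne_zero.2 hne
  have hd := (hsm _ hw0).hasFDerivAt
  set ℓ := fderiv ℝ q (f u - w)
  -- Euler's identity for the homogeneous function `q`, from its derivative along the ray through `f
  -- u - w`.
  have hℓ : ℓ (f u - w) = q (f u - w) := by
    have h1 : HasDerivAt (fun t : ℝ => (f u - w) + t • (f u - w)) (f u - w) 0 := by
      simpa using ((hasDerivAt_id (0 : ℝ)).smul_const (f u - w)).const_add (f u - w)
    have h2 : HasDerivAt (fun t : ℝ => q ((f u - w) + t • (f u - w))) (ℓ (f u - w)) 0 := by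
      refine HasFDerivAt.comp_hasDerivAt (0 : ℝ) ?_ h1
      simpa using hd
    have h3 : HasDerivAt (fun t : ℝ => (1 + t) * q (f u - w)) (q (f u - w)) 0 := by
      simpa using ((hasDerivAt_id (0 : ℝ)).const_add 1).mul_const (q (f u - w))
    refine h2.unique (h3.congr_of_eventuallyEq ?_)
    filter_upwards [lt_mem_nhds (show (-1 : ℝ) < 0 by norm_num)] with t ht
    rw [show (f u - w) + t • (f u - w) = (1 + t) • (f u - w) by rw [add_smul, one_smul],
      map_smul_eq_mul, Real.norm_eq_abs, abs_of_pos (by linarith)]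
  obtain ⟨hJ1, hJ2, hJ3⟩ := hJ u huball
  obtain ⟨T, hT, hTle⟩ := exists_norm_comp_le_of_isWOTCompact hJ1.1 hJ2 hJ3 ℓ hε.le
    (neg_le_iSup_of_isPseudoJacobianAt hJ1 hd
      (Metric.closedBall_mem_nhds_of_mem huball) hL fun z hz => by
        have := hu2 z hz
        rwa [dist_eq_norm'] at this)
  obtain ⟨hsurj, hlow⟩ := hinv u huball T hT
  obtain ⟨v, hv⟩ := hsurj (f u - w)
  have h1 := hlow v
  have h2 := (ℓ ∘L T).le_of_opNorm_le hTle v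
  simp only [ContinuousLinearMap.comp_apply, hv, hℓ, Real.norm_eq_abs,
    abs_of_nonneg (apply_nonneg q (f u - w))] at h1 h2
  have h3 := hmq (f u - w)
  have h4 := norm_pos_iff.2 hw0
  have h5 : ε * ‖v‖ ≤ m / 2 * ‖f u - w‖ := by
    rw [hεdef]; nlinarith
  nlinarith

/-- Scalar mean value inequality for pseudo-Jacobians. -/
theorem apply_sub_le_of_isPseudoJacobianAt {f : E → F} {J : E → Set (E →L[ℝ] F)} {a b : E}
    (hf : ContinuousOn f (segment ℝ a b))
    (hJ : ∀ z ∈ segment ℝ a b, IsPseudoJacobianAt f z (J z)) (y : F →L[ℝ] ℝ) {C : ℝ}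
    (hC : ∀ z ∈ segment ℝ a b, ∀ T ∈ J z, y (T (b - a)) ≤ C) : y (f b - f a) ≤ C := by
  have hseg : ∀ t ∈ Icc (0 : ℝ) 1, a + t • (b - a) ∈ segment ℝ a b := fun t ht => by
    rw [segment_eq_image']; exact ⟨t, ht, rfl⟩
  -- On `[0, 1]` the scalar function has upper right Dini derivative at most `C`, so it stays below
  -- the line `C t`.
  have key := image_le_of_liminf_slope_right_le_deriv_boundary
    (f := fun t : ℝ => y (f (a + t • (b - a))) - y (f a)) (a := 0) (b := 1)
    (B := fun t => C * t) (B' := fun _ => C) ?_ (by simp) (by fun_prop) ?_ ?_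
    (right_mem_Icc.2 zero_le_one)
  · simpa using key
  · refine ContinuousOn.sub ?_ continuousOn_const
    exact y.continuous.comp_continuousOn (hf.comp (by fun_prop) hseg)
  · intro t _
    simpa using ((hasDerivAt_id t).const_mul C).hasDerivWithinAt
  · intro t ht r hr
    have ht' := hseg t ⟨ht.1, ht.2.le⟩
    have h1 : limsup (fun s : ℝ => (((y (f (a + t • (b - a) + s • (b - a))) -
        y (f (a + t • (b - a)))) / s : ℝ) : EReal)) (𝓝[>] 0) < (r : EReal) := by
      refine ((hJ _ ht').2 y (b - a)).trans_lt (lt_of_le_of_lt ?_ (EReal.coe_lt_coe_iff.2 hr))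
      exact iSup₂_le fun T hT => EReal.coe_le_coe_iff.2 (hC _ ht' T hT)
    have h2 := eventually_lt_of_limsup_lt h1
    have h3 : Tendsto (fun z : ℝ => z - t) (𝓝[>] t) (𝓝[>] 0) := by
      refine tendsto_nhdsWithin_of_tendsto_nhds_of_eventually_within _ ?_ ?_
      · have : Tendsto (fun z : ℝ => z - t) (𝓝 t) (𝓝 (t - t)) := by
          exact (continuous_id.sub continuous_const).tendsto t
        rw [sub_self] at this
        exact this.mono_left nhdsWithin_le_nhds
      · filter_upwards [self_mem_nhdsWithin] with z hz
        exact mem_Ioi.2 (sub_pos.2 (mem_Ioi.1 hz))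
    refine Eventually.frequently ?_
    filter_upwards [h3.eventually h2] with z hz
    have h4 : a + t • (b - a) + (z - t) • (b - a) = a + z • (b - a) := by module
    rw [h4] at hz
    have h5 := EReal.coe_lt_coe_iff.1 hz
    rw [slope_def_field]
    simpa using h5

/-- Mean value inequality: if every operator of the convex set `S` expands by the factor `κ`, then
so does a map whose pseudo-Jacobians are contained in `S`. -/
theorem le_seminorm_sub_of_isPseudoJacobianAt {f : E → F} {J : E → Set (E →L[ℝ] F)} {a b : E}
    (hf : ContinuousOn f (segment ℝ a b))
    (hJ : ∀ z ∈ segment ℝ a b, IsPseudoJacobianAt f z (J z)) {S : Set (E →L[ℝ] F)}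
    (hS : Convex ℝ S) (hJS : ∀ z ∈ segment ℝ a b, J z ⊆ S) (p : Seminorm ℝ E) (q : Seminorm ℝ F)
    (hq : Continuous q) {κ : ℝ} (hκ : ∀ T ∈ S, κ * p (b - a) ≤ q (T (b - a))) :
    κ * p (b - a) ≤ q (f b - f a) := by
  by_contra! hlt
  -- The open ball contains `f b - f a` but no `T (b - a)`. The separating functional is below `c`
  -- on the ball and at least `c` on the operators, and the scalar inequality for `-y` carries the
  -- latter bound over to `f b - f a`.
  obtain ⟨y, c, hy1, hy2⟩ := geometric_hahn_banach_open
    (s := q.ball 0 (κ * p (b - a))) (t := (fun T : E →L[ℝ] F => T (b - a)) '' S)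
    (q.convex_ball _ _) (by
      rw [Seminorm.ball_zero_eq]
      exact isOpen_lt hq continuous_const)
    (hS.is_linear_image ⟨fun _ _ => rfl, fun _ _ => rfl⟩)
    (by
      rw [Set.disjoint_left]
      rintro _ hw ⟨T, hT, rfl⟩
      rw [Seminorm.mem_ball_zero] at hw
      exact (hκ T hT).not_gt hw)
  have h1 := hy1 (f b - f a) (by rwa [Seminorm.mem_ball_zero])
  have h2 := apply_sub_le_of_isPseudoJacobianAt hf hJ (-y) (C := -c) fun z hz T hT => by
    exact neg_le_neg (hy2 _ ⟨T, hJS z hz hT, rfl⟩)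
  simp only [neg_apply] at h2
  linarith

end BanachSpaces

/-! ### The Banach constants of an isomorphism -/

section BanachConstants

variable {V V' : Type*} [AddCommGroup V] [Module ℝ V] [TopologicalSpace V]
  [AddCommGroup V'] [Module ℝ V'] [TopologicalSpace V'] {p : Seminorm ℝ V} {q : Seminorm ℝ V'}

/-- By homogeneity. Vectors with `p v = 0` cost nothing because `q ≥ 0`, and an empty unit sphere
needs no separate case. -/
theorem ofReal_le_dualBanachConstant_iff {T : V →L[ℝ] V'} {c : ℝ} :
    ENNReal.ofReal c ≤ dualBanachConstant p q T ↔ ∀ v, c * p v ≤ q (T v) := by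
  simp only [dualBanachConstant, le_iInf_iff]
  constructor
  · intro h v
    rcases (apply_nonneg p v).eq_or_lt with h0 | h0
    · rw [← h0, mul_zero]; exact apply_nonneg q _
    · have h1 := h ((p v)⁻¹ • v) (by
        rw [map_smul_eq_mul, Real.norm_eq_abs, abs_of_pos (inv_pos.2 h0), inv_mul_cancel₀ h0.ne'])
      rw [ENNReal.ofReal_le_ofReal_iff (apply_nonneg q _), map_smul, map_smul_eq_mul,
        Real.norm_eq_abs, abs_of_pos (inv_pos.2 h0), ← div_eq_inv_mul, le_div_iff₀ h0] at h1
      exact h1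
  · intro h v hv
    have := h v
    rw [hv, mul_one] at this
    exact ENNReal.ofReal_le_ofReal this

theorem le_dualNorm {v : V} (hv : p v ≤ 1) (y : V →L[ℝ] ℝ) :
    ENNReal.ofReal |y v| ≤ dualNorm p y :=
  le_iSup₂_of_le v hv le_rfl

/-- Each `w` in the unit ball of `q` is some `T v`, and then `c • v` lies in the unit ball of `p`;
it tests `y ∘ T` with the value `c * y w`. -/
theorem ofReal_le_banachConstant_of_forall_le {T : V →L[ℝ] V'} (hT : Function.Surjective T) {c : ℝ}
    (hc : 0 ≤ c) (h : ∀ v, c * p v ≤ q (T v)) : ENNReal.ofReal c ≤ banachConstant p q T := by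
  simp only [banachConstant, le_iInf_iff]
  intro y hy
  rw [← mul_one (ENNReal.ofReal c), ← hy, dualNorm, ENNReal.mul_iSup]
  refine iSup_le fun w => ?_
  rw [ENNReal.mul_iSup]
  refine iSup_le fun hw => ?_
  obtain ⟨v, rfl⟩ := hT w
  have h1 := le_dualNorm (p := p) (v := c • v) (by
    rw [map_smul_eq_mul, Real.norm_eq_abs, abs_of_nonneg hc]
    exact (h v).trans hw) (y ∘L T)
  simpa [abs_mul, abs_of_nonneg hc, ENNReal.ofReal_mul hc] using h1

/-- If the bound fails at `v`, Hahn–Banach gives `ξ` with `ξ v > u` and `|ξ| ≤ u / s` on the unit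
ball, where `q (T v) < c s`. Since `T` is invertible, `ξ = y ∘ T`; the normalization of `y` has dual
norm 1, but its pull-back has dual norm below `c`. -/
theorem forall_le_of_ofReal_le_banachConstant [IsTopologicalAddGroup V] [ContinuousSMul ℝ V]
    [LocallyConvexSpace ℝ V] (hp : Continuous p)
    (hq : ∀ y : V' →L[ℝ] ℝ, ∃ D, ∀ w, |y w| ≤ D * q w) (T : V ≃L[ℝ] V') {c : ℝ} (hc : 0 < c)
    (h : ENNReal.ofReal c ≤ banachConstant p q (T : V →L[ℝ] V')) (v : V) : c * p v ≤ q (T v) := by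
  by_contra! hlt
  obtain ⟨s, hs1, hs2⟩ := exists_between (show q (T v) / c < p v by rwa [div_lt_iff₀' hc])
  have hs0 : 0 < s := lt_of_le_of_lt (div_nonneg (apply_nonneg q _) hc.le) hs1
  have hs1 : q (T v) < c * s := by rwa [div_lt_iff₀' hc] at hs1
  obtain ⟨ξ, u, hξ, hu⟩ := geometric_hahn_banach_closed_point (s := {a | p a ≤ s}) (x := v)
    (by
      have := p.convex_closedBall 0 s
      rwa [Seminorm.closedBall_zero_eq] at this)
    (isClosed_le hp continuous_const) (not_le.2 hs2)
  have hu0 : 0 < u := by simpa using hξ 0 (by simpa using hs0.le)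
  have hξp : ∀ a, p a ≤ 1 → |ξ a| ≤ u / s := by
    intro a ha
    have hmem : p (s • a) ≤ s := by
      rw [map_smul_eq_mul, Real.norm_eq_abs, abs_of_pos hs0]; nlinarith
    have h1 := hξ (s • a) hmem
    have h2 := hξ (-(s • a)) (by rw [mem_ofPred_eq, map_neg_eq_map]; exact hmem)
    simp only [map_neg, map_smul, smul_eq_mul] at h1 h2
    rw [abs_le, le_div_iff₀ hs0, neg_le, le_div_iff₀ hs0]
    constructor <;> linarith
  set y : V' →L[ℝ] ℝ := ξ ∘L (T.symm : V' →L[ℝ] V) with hy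
  have hyT : ∀ w, y (T w) = ξ w := fun w => by simp [hy]
  obtain ⟨D₀, hD₀⟩ := hq y
  have hfin : dualNorm q y ≠ ⊤ := by
    refine ne_top_of_le_ne_top (b := ENNReal.ofReal |D₀|) ENNReal.ofReal_ne_top ?_
    refine iSup₂_le fun w hw => ENNReal.ofReal_le_ofReal ((hD₀ w).trans ?_)
    calc D₀ * q w ≤ |D₀| * q w := by exact mul_le_mul_of_nonneg_right (le_abs_self _) (apply_nonneg q _)
      _ ≤ |D₀| * 1 := by gcongr
      _ = |D₀| := mul_one _
  set D := (dualNorm q y).toReal with hD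
  have hDeq : dualNorm q y = ENNReal.ofReal D := (ENNReal.ofReal_toReal hfin).symm
  have hD0 : 0 ≤ D := ENNReal.toReal_nonneg
  have hyq : ∀ w, q w ≤ 1 → |y w| ≤ D := fun w hw => by
    have := le_dualNorm hw y
    rw [hDeq, ENNReal.ofReal_le_ofReal_iff hD0] at this
    exact this
  have hyv : 0 < y (T v) := by rw [hyT]; linarith
  -- The domination `hq` rules out `q (T v) = 0`, as `y (T v)` is positive.
  have hqv : 0 < q (T v) := by
    by_contra! h0
    have h1 := hD₀ (T v)
    rw [le_antisymm h0 (apply_nonneg q _), mul_zero, abs_of_pos hyv] at h1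
    linarith
  have hyTv : y (T v) ≤ D * q (T v) := by
    have h1 := hyq ((q (T v))⁻¹ • T v) (by
      rw [map_smul_eq_mul, Real.norm_eq_abs, abs_of_pos (inv_pos.2 hqv), inv_mul_cancel₀ hqv.ne'])
    rw [map_smul, smul_eq_mul, abs_mul, abs_of_pos hyv, abs_of_pos (inv_pos.2 hqv),
      ← div_eq_inv_mul, div_le_iff₀ hqv] at h1
    exact h1
  have hDpos : 0 < D := by
    by_contra! h0
    nlinarith
  have hscale : ∀ {W : Type _} [AddCommGroup W] [Module ℝ W] [TopologicalSpace W]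
      (r : Seminorm ℝ W) (z : W →L[ℝ] ℝ), dualNorm r (D⁻¹ • z) =
        ENNReal.ofReal D⁻¹ * dualNorm r z := by
    intro W _ _ _ r z
    simp only [dualNorm, ENNReal.mul_iSup]
    refine iSup_congr fun w => iSup_congr fun _ => ?_
    rw [← ENNReal.ofReal_mul (inv_nonneg.2 hD0), smul_apply, smul_eq_mul,
      abs_mul, abs_of_pos (inv_pos.2 hDpos)]
  have hone : dualNorm q (D⁻¹ • y) = 1 := by
    rw [hscale, hDeq, ← ENNReal.ofReal_mul (inv_nonneg.2 hD0), inv_mul_cancel₀ hDpos.ne',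
      ENNReal.ofReal_one]
  have h1 : ENNReal.ofReal c ≤ dualNorm p ((D⁻¹ • y) ∘L (T : V →L[ℝ] V')) :=
    h.trans (iInf₂_le (D⁻¹ • y) hone)
  have h2 : dualNorm p ((D⁻¹ • y) ∘L (T : V →L[ℝ] V')) ≤ ENNReal.ofReal (D⁻¹ * (u / s)) := by
    refine iSup₂_le fun a ha => ENNReal.ofReal_le_ofReal ?_
    have : ((D⁻¹ • y) ∘L (T : V →L[ℝ] V')) a = D⁻¹ * ξ a := by simp [hyT]
    rw [this, abs_mul, abs_of_pos (inv_pos.2 hDpos)]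
    gcongr
    exact hξp a ha
  have h3 := (ENNReal.ofReal_le_ofReal_iff (by positivity)).1 (h1.trans h2)
  rw [← div_eq_inv_mul, div_div, le_div_iff₀ (by positivity)] at h3
  rw [hyT] at hyTv
  nlinarith

/-- For an isomorphism both constants encode the norm of the inverse. Comparing their finite lower
bounds also covers the value `∞`. -/
theorem banachConstant_eq_dualBanachConstant [IsTopologicalAddGroup V] [ContinuousSMul ℝ V]
    [LocallyConvexSpace ℝ V] (hp : Continuous p)
    (hq : ∀ y : V' →L[ℝ] ℝ, ∃ D, ∀ w, |y w| ≤ D * q w) (T : V ≃L[ℝ] V') :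
    banachConstant p q (T : V →L[ℝ] V') = dualBanachConstant p q (T : V →L[ℝ] V') := by
  refine le_antisymm (ENNReal.le_of_forall_nnreal_lt fun r hr => ?_)
    (ENNReal.le_of_forall_nnreal_lt fun r hr => ?_)
  · rcases eq_zero_or_pos r with rfl | h0
    · simp
    rw [← ENNReal.ofReal_coe_nnreal] at hr ⊢
    exact ofReal_le_dualBanachConstant_iff.2 fun v =>
      forall_le_of_ofReal_le_banachConstant hp hq T h0 hr.le v
  · rw [← ENNReal.ofReal_coe_nnreal] at hr ⊢
    exact ofReal_le_banachConstant_of_forall_le T.surjective r.2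
      (ofReal_le_dualBanachConstant_iff.1 hr.le)

end BanachConstants

/-! ### Stability of expanding isomorphisms -/

section Perturbation

variable {E F : Type*} [NormedAddCommGroup E] [NormedSpace ℝ E] [CompleteSpace E]
  [NormedAddCommGroup F] [NormedSpace ℝ F] [CompleteSpace F]

/-- Neumann series: `S = T (1 + A)` with `A = T⁻¹ (S - T)`, and `hε` makes `‖A‖ < 1`. The triangle
inequality bounds the loss in the expansion factor. -/
theorem bijective_and_forall_le_of_norm_sub_le {T S : E →L[ℝ] F} (hT : Function.Bijective T)
    (p : Seminorm ℝ E) (q : Seminorm ℝ F) {m M κ ε : ℝ} (hm : 0 < m) (hM : 0 < M) (hκ : 0 < κ)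
    (hmp : ∀ v, m * ‖v‖ ≤ p v) (hqM : ∀ w, q w ≤ M * ‖w‖) (hTp : ∀ v, κ * p v ≤ q (T v))
    (hST : ‖S - T‖ ≤ ε) (hε : M * ε < κ * m) :
    Function.Bijective S ∧ ∀ v, (κ - M * ε / m) * p v ≤ q (S v) := by
  have hε0 : 0 ≤ ε := (norm_nonneg _).trans hST
  have hdiff : ∀ v, q ((S - T) v) ≤ M * ε * ‖v‖ := fun v => by
    refine (hqM _).trans ?_
    rw [mul_assoc]
    gcongr
    exact (S - T).le_of_opNorm_le hST v
  constructor
  · set e := ContinuousLinearEquiv.ofBijective T (LinearMap.ker_eq_bot.2 hT.1)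
      (LinearMap.range_eq_top.2 hT.2) with he
    have heT : ∀ v, e v = T v := fun v => rfl
    set A : E →L[ℝ] E := (e.symm : F →L[ℝ] E) ∘L (S - T) with hA
    have hAnorm : ‖A‖ ≤ M * ε / (κ * m) := by
      refine ContinuousLinearMap.opNorm_le_bound _ (by positivity) fun v => ?_
      have h1 := hTp (A v)
      have h2 : T (A v) = (S - T) v := by
        rw [← heT]; simp [hA]
      rw [h2] at h1
      have h3 := hmp (A v)
      have h4 := hdiff v
      rw [div_mul_eq_mul_div, le_div_iff₀ (by positivity)]
      nlinarith
    have hA1 : ‖-A‖ < 1 := by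
      rw [norm_neg]
      refine hAnorm.trans_lt ?_
      rw [div_lt_one (by positivity)]
      exact hε
    have hunit : IsUnit (1 + A) := by
      have := (Units.oneSub (-A) hA1).isUnit
      simpa using this
    have hbij : Function.Bijective (1 + A : E →L[ℝ] E) := by
      obtain ⟨U, hU⟩ := hunit
      rw [← hU]
      exact (ContinuousLinearEquiv.ofUnit U).bijective
    have hS : ∀ v, S v = e ((1 + A) v) := fun v => by
      have : (1 + A) v = v + e.symm ((S - T) v) := rfl
      rw [this, map_add, heT, ContinuousLinearEquiv.apply_symm_apply]
      simp
    have : (S : E → F) = e ∘ (1 + A : E →L[ℝ] E) := funext hS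
    rw [this]
    exact e.bijective.comp hbij
  · intro v
    have h1 := hTp v
    have h2 := hdiff v
    have h3 : q (T v) ≤ q (S v) + q ((S - T) v) := by
      have := map_sub_le_add q (S v) ((S - T) v)
      simpa using this
    have h4 : M * ε * ‖v‖ ≤ M * ε / m * p v := by
      rw [div_mul_eq_mul_div, le_div_iff₀ hm]
      have := hmp v
      have h5 : 0 ≤ M * ε := by positivity
      nlinarith
    linarith

end Perturbation

/-! ### Differentials of charts -/

section ChartDerivatives

variable {E : Type*} [NormedAddCommGroup E] [NormedSpace ℝ E]
  {X : Type*} [TopologicalSpace X] [ChartedSpace E X]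

theorem IsChartAt.of_mem {φ : OpenPartialHomeomorph X E} {x u : X} (hφ : IsChartAt φ x)
    (hu : u ∈ φ.source) : IsChartAt φ u := ⟨hφ.1, hu⟩

theorem IsChartAt.hasMFDerivAt {φ : OpenPartialHomeomorph X E} {u : X} (hφ : IsChartAt φ u) :
    HasMFDerivAt 𝓘(ℝ, E) 𝓘(ℝ, E) φ u (chartDeriv φ u) :=
  (mdifferentiableAt_of_mem_maximalAtlas hφ.1 hφ.2).hasMFDerivAt

theorem IsChartAt.hasMFDerivAt_symm {φ : OpenPartialHomeomorph X E} {u : X}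
    (hφ : IsChartAt φ u) :
    HasMFDerivAt 𝓘(ℝ, E) 𝓘(ℝ, E) φ.symm (φ u) (chartDerivSymm φ u) :=
  (mdifferentiableAt_symm_of_mem_maximalAtlas hφ.1 (φ.map_source hφ.2)).hasMFDerivAt

theorem IsChartAt.hasFDerivAt_comp_symm {φ φ' : OpenPartialHomeomorph X E} {u : X}
    (hφ : IsChartAt φ u) (hφ' : IsChartAt φ' u) :
    HasFDerivAt (φ ∘ φ'.symm) (chartDeriv φ u ∘L chartDerivSymm φ' u : E →L[ℝ] E) (φ' u) := by
  -- The chain rule lands at `φ'.symm (φ' u)`, which equals `u` only propositionally; the quantified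
  -- form moves the derivative there.
  have h1 : ∀ w, w = u → HasMFDerivAt 𝓘(ℝ, E) 𝓘(ℝ, E) φ w (chartDeriv φ u : E →L[ℝ] E) := by
    rintro _ rfl
    exact hφ.hasMFDerivAt
  exact hasMFDerivAt_iff_hasFDerivAt.1
    (HasMFDerivAt.comp (φ' u) (h1 _ (φ'.left_inv hφ'.2)) hφ'.hasMFDerivAt_symm)

theorem IsChartAt.chartDeriv_chartDerivSymm {φ : OpenPartialHomeomorph X E} {u : X}
    (hφ : IsChartAt φ u) (v : E) : chartDeriv φ u (chartDerivSymm φ u v) = v := by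
  have h1 := hφ.hasFDerivAt_comp_symm hφ
  have h2 : HasFDerivAt (φ ∘ φ.symm) (ContinuousLinearMap.id ℝ E) (φ u) := by
    refine (hasFDerivAt_id (φ u)).congr_of_eventuallyEq ?_
    filter_upwards [φ.open_target.mem_nhds (φ.map_source hφ.2)] with z hz
    exact φ.right_inv hz
  exact congrArg (fun L : E →L[ℝ] E => L v) (h1.unique h2)

theorem IsChartAt.chartDerivSymm_chartDeriv {φ : OpenPartialHomeomorph X E} {u : X}
    (hφ : IsChartAt φ u) (v : TangentSpace 𝓘(ℝ, E) u) :
    chartDerivSymm φ u (chartDeriv φ u v) = v := by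
  have h1 : HasMFDerivAt 𝓘(ℝ, E) 𝓘(ℝ, E) (φ.symm ∘ φ) u
      (chartDerivSymm φ u ∘L chartDeriv φ u) :=
    HasMFDerivAt.comp u hφ.hasMFDerivAt_symm hφ.hasMFDerivAt
  have h2 : HasMFDerivAt 𝓘(ℝ, E) 𝓘(ℝ, E) (φ.symm ∘ φ) u
      (ContinuousLinearMap.id ℝ (TangentSpace 𝓘(ℝ, E) u)) := by
    refine (hasMFDerivAt_id u).congr_of_eventuallyEq ?_
    filter_upwards [φ.open_source.mem_nhds hφ.2] with z hz
    exact φ.left_inv hz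
  exact congrArg (fun L : TangentSpace 𝓘(ℝ, E) u →L[ℝ] TangentSpace 𝓘(ℝ, E) u => L v)
    (hasMFDerivAt_unique h1 h2)

/-- The differential of a chart as an isomorphism `T_u X ≃ E`. -/
def IsChartAt.derivEquiv {φ : OpenPartialHomeomorph X E} {u : X} (hφ : IsChartAt φ u) :
    TangentSpace 𝓘(ℝ, E) u ≃L[ℝ] E :=
  ContinuousLinearEquiv.equivOfInverse (chartDeriv φ u) (chartDerivSymm φ u)
    hφ.chartDerivSymm_chartDeriv hφ.chartDeriv_chartDerivSymm

end ChartDerivatives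

/-- Hahn–Banach for a continuous seminorm: a functional dominated by `p` and norming `d`. -/
theorem exists_dual_apply_eq_seminorm {E : Type*} [NormedAddCommGroup E] [NormedSpace ℝ E]
    (p : Seminorm ℝ E) {M : ℝ} (hpM : ∀ v, p v ≤ M * ‖v‖) (d : E) :
    ∃ y : E →L[ℝ] ℝ, y d = p d ∧ ∀ v, |y v| ≤ p v := by
  rcases eq_or_ne d 0 with rfl | hd
  · exact ⟨0, by simp, fun v => by simp⟩
  obtain ⟨g, hg1, hg2⟩ := exists_extension_of_le_sublinear
    (LinearPMap.mkSpanSingleton (K := ℝ) d (p d) hd) p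
    (fun c hc v => by rw [map_smul_eq_mul, Real.norm_eq_abs, abs_of_pos hc])
    (fun v w => map_add_le_add p v w) (by
      rintro ⟨v, hv⟩
      obtain ⟨c, rfl⟩ := Submodule.mem_span_singleton.1 hv
      rw [LinearPMap.mkSpanSingleton'_apply, map_smul_eq_mul, smul_eq_mul, Real.norm_eq_abs]
      exact mul_le_mul_of_nonneg_right (le_abs_self c) (apply_nonneg p d))
  have hgp : ∀ v, |g v| ≤ p v := fun v => by
    refine abs_le.2 ⟨?_, hg2 v⟩
    have := hg2 (-v)
    rw [map_neg, map_neg_eq_map] at this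
    linarith
  refine ⟨g.mkContinuous M fun v => (hgp v).trans (hpM v), ?_, hgp⟩
  have h1 := hg1 ⟨d, Submodule.mem_span_singleton_self (R := ℝ) d⟩
  exact h1.trans (LinearPMap.mkSpanSingleton_apply ℝ _ hd (p d))

/-! ### Finsler norms in charts and lengths of paths -/

namespace FinslerStructure

variable {E : Type*} [NormedAddCommGroup E] [NormedSpace ℝ E]
  {X : Type*} [TopologicalSpace X] [ChartedSpace E X] [IsManifold 𝓘(ℝ, E) 1 X]
  (N : FinslerStructure E X)

/-- The Finsler norm at `u` read in the chart `φ`. -/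
def chartNorm (φ : OpenPartialHomeomorph X E) (u : X) : Seminorm ℝ E :=
  (N.norm u).comp (chartDerivSymm φ u : E →ₗ[ℝ] TangentSpace 𝓘(ℝ, E) u)

theorem chartNorm_apply (φ : OpenPartialHomeomorph X E) (u : X) (v : E) :
    N.chartNorm φ u v = N.norm u (chartDerivSymm φ u v) := rfl

theorem norm_eq_chartNorm {φ : OpenPartialHomeomorph X E} {u : X} (hφ : IsChartAt φ u)
    (v : TangentSpace 𝓘(ℝ, E) u) : N.norm u v = N.chartNorm φ u (chartDeriv φ u v) := by
  rw [chartNorm_apply, hφ.chartDerivSymm_chartDeriv]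

theorem exists_chartNorm_bounds {φ : OpenPartialHomeomorph X E} {u : X} (hφ : IsChartAt φ u) :
    ∃ m > 0, ∃ M > 0, ∀ v, m * ‖v‖ ≤ N.chartNorm φ u v ∧ N.chartNorm φ u v ≤ M * ‖v‖ :=
  N.equivalent u φ hφ

theorem continuous_chartNorm {φ : OpenPartialHomeomorph X E} {u : X} (hφ : IsChartAt φ u) :
    Continuous (N.chartNorm φ u) := by
  obtain ⟨m, hm, M, hM, h⟩ := N.exists_chartNorm_bounds hφ
  refine Seminorm.continuous_of_le (q := M.toNNReal • normSeminorm ℝ E) ?_ fun w => ?_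
  · exact Continuous.congr (f := fun w : E => (M.toNNReal : ℝ) * ‖w‖) (by fun_prop) fun w => rfl
  · refine (h w).2.trans (le_of_eq ?_)
    change M * ‖w‖ = (M.toNNReal : ℝ) * ‖w‖
    rw [Real.coe_toNNReal _ hM.le]

theorem continuous_norm_apply (u : X) : Continuous (N.norm u) := by
  have hφ : IsChartAt (chartAt E u) u :=
    ⟨IsManifold.chart_mem_maximalAtlas u, mem_chart_source E u⟩
  have h := (N.continuous_chartNorm hφ).comp (chartDeriv (chartAt E u) u).continuous
  exact h.congr fun v => (N.norm_eq_chartNorm hφ v).symm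

/-- The Finsler norms as extended norms on the tangent spaces. -/
@[reducible] def tangentENorm (z : X) : ENorm (TangentSpace 𝓘(ℝ, E) z) :=
  ⟨fun v => ENNReal.ofReal (N.norm z v)⟩

/-- The Finsler length of a path on `[a, b]`. -/
def pathLength (γ : ℝ → X) (a b : ℝ) : ℝ≥0∞ :=
  letI := N.tangentENorm
  Manifold.pathELength 𝓘(ℝ, E) γ a b

/-- Homogeneity of the norms, on which the invariance of length under reparametrization rests. -/
theorem tangentENormSMulClass (z : X) :
    letI := N.tangentENorm
    ENormSMulClass ℝ (TangentSpace 𝓘(ℝ, E) z) := by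
  let _ := N.tangentENorm
  refine ⟨fun r v => ?_⟩
  change ENNReal.ofReal (N.norm z (r • v)) = ‖r‖ₑ * ENNReal.ofReal (N.norm z v)
  rw [map_smul_eq_mul, ENNReal.ofReal_mul (norm_nonneg r), ofReal_norm]

theorem edist_self (x : X) : N.edist x x = 0 := by
  let _ := N.tangentENorm
  have := N.tangentENormSMulClass
  exact Manifold.riemannianEDist_self

theorem edist_comm (x y : X) : N.edist x y = N.edist y x := by
  let _ := N.tangentENorm
  have := N.tangentENormSMulClass
  exact Manifold.riemannianEDist_comm

theorem edist_triangle (x y z : X) : N.edist x z ≤ N.edist x y + N.edist y z := by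
  let _ := N.tangentENorm
  have := N.tangentENormSMulClass
  exact Manifold.riemannianEDist_triangle

theorem edist_le_pathLength {γ : ℝ → X} {a b : ℝ}
    (hγ : ContMDiffOn 𝓘(ℝ, ℝ) 𝓘(ℝ, E) 1 γ (Icc a b)) (hab : a ≤ b) :
    N.edist (γ a) (γ b) ≤ N.pathLength γ a b := by
  let _ := N.tangentENorm
  have := N.tangentENormSMulClass
  exact Manifold.riemannianEDist_le_pathELength hγ rfl rfl hab

theorem exists_path_of_edist_lt {x y : X} {r : ℝ≥0∞} (h : N.edist x y < r) :
    ∃ γ : ℝ → X, γ 0 = x ∧ γ 1 = y ∧ ContMDiff 𝓘(ℝ, ℝ) 𝓘(ℝ, E) 1 γ ∧ N.pathLength γ 0 1 < r := by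
  let _ := N.tangentENorm
  have := N.tangentENormSMulClass
  obtain ⟨γ, h0, h1, h2, h3, -⟩ :=
    Manifold.exists_lt_locally_constant_of_riemannianEDist_lt h zero_lt_one
  exact ⟨γ, h0, h1, h2, h3⟩

theorem pathLength_mono {γ : ℝ → X} {a b a' b' : ℝ} (h : a' ≤ a) (h' : b ≤ b') :
    N.pathLength γ a b ≤ N.pathLength γ a' b' := by
  let _ := N.tangentENorm
  exact Manifold.pathELength_mono h h'

theorem pathLength_eq_lintegral (γ : ℝ → X) (a b : ℝ) :
    N.pathLength γ a b = ∫⁻ t in Icc a b,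
      ENNReal.ofReal (N.norm (γ t) (mfderivWithin 𝓘(ℝ, ℝ) 𝓘(ℝ, E) γ (Icc a b) t (1 : ℝ))) := by
  let _ := N.tangentENorm
  exact Manifold.pathELength_eq_lintegral_mfderivWithin_Icc

end FinslerStructure

namespace FinslerStructure

variable {E : Type*} [NormedAddCommGroup E] [NormedSpace ℝ E]
  {X : Type*} [TopologicalSpace X] [ChartedSpace E X] [IsManifold 𝓘(ℝ, E) 1 X]
  (N : FinslerStructure E X)

/-- The displacement in a chart is at most the length of the path, up to the distortion of the
norms. -/
theorem seminorm_sub_le_pathLength {φ : OpenPartialHomeomorph X E} {x₀ : X}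
    (hφ : IsChartAt φ x₀) {O : Set X} (hO : O ⊆ φ.source) {k : ℝ} (hk : 0 ≤ k)
    (hclose : ∀ u ∈ O, ∀ v, N.chartNorm φ x₀ v ≤ k * N.chartNorm φ u v) {γ : ℝ → X} {t : ℝ}
    (ht : 0 ≤ t) (hγ : ContMDiff 𝓘(ℝ, ℝ) 𝓘(ℝ, E) 1 γ) (hγO : ∀ s ∈ Icc 0 t, γ s ∈ O) :
    ENNReal.ofReal (N.chartNorm φ x₀ (φ (γ t) - φ (γ 0))) ≤
      ENNReal.ofReal k * N.pathLength γ 0 t := by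
  rcases ht.eq_or_lt with rfl | htpos
  · simp
  obtain ⟨m, hm, M, hM, hmM⟩ := N.exists_chartNorm_bounds hφ
  -- A functional norming the displacement reduces the estimate to the fundamental theorem of
  -- calculus for the scalar function `y ∘ φ ∘ γ`.
  obtain ⟨y, hy1, hy2⟩ := exists_dual_apply_eq_seminorm (N.chartNorm φ x₀) (fun v => (hmM v).2)
    (φ (γ t) - φ (γ 0))
  have hφγ : ContMDiffOn 𝓘(ℝ, ℝ) 𝓘(ℝ, E) 1 (φ ∘ γ) (Icc 0 t) :=
    (contMDiffOn_of_mem_maximalAtlas hφ.1).comp hγ.contMDiffOn fun s hs => hO (hγO s hs)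
  have hg : ContDiffOn ℝ 1 (y ∘ φ ∘ γ) (Icc 0 t) :=
    y.contDiff.comp_contDiffOn (contMDiffOn_iff_contDiffOn.1 hφγ)
  have h1 := enorm_sub_le_lintegral_derivWithin_Icc_of_contDiffOn_Icc hg ht
  have h2 : ‖(y ∘ φ ∘ γ) t - (y ∘ φ ∘ γ) 0‖ₑ =
      ENNReal.ofReal (N.chartNorm φ x₀ (φ (γ t) - φ (γ 0))) := by
    simp only [Function.comp_apply]
    rw [← map_sub, hy1, Real.enorm_of_nonneg (apply_nonneg _ _)]
  rw [← h2]
  refine h1.trans ?_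
  rw [N.pathLength_eq_lintegral, ← MeasureTheory.lintegral_const_mul' _ _ ENNReal.ofReal_ne_top]
  refine MeasureTheory.setLIntegral_mono' measurableSet_Icc fun s hs => ?_
  have hs' := hγO s hs
  have hφs := hφ.of_mem (hO hs')
  have hγs : HasMFDerivWithinAt 𝓘(ℝ, ℝ) 𝓘(ℝ, E) γ (Icc 0 t) s
      (mfderivWithin 𝓘(ℝ, ℝ) 𝓘(ℝ, E) γ (Icc 0 t) s) :=
    ((hγ.mdifferentiable one_ne_zero) s).mdifferentiableWithinAt.hasMFDerivWithinAt
  have h3 : HasMFDerivWithinAt 𝓘(ℝ, ℝ) 𝓘(ℝ, E) (φ ∘ γ) (Icc 0 t) s _ :=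
    hφs.hasMFDerivAt.comp_hasMFDerivWithinAt s hγs
  have h4 : HasFDerivWithinAt (φ ∘ γ) _ (Icc 0 t) s := hasMFDerivWithinAt_iff_hasFDerivWithinAt.1 h3
  have h5 := (y.hasFDerivAt.comp_hasFDerivWithinAt s h4).hasDerivWithinAt.derivWithin
    (uniqueDiffOn_Icc htpos s hs)
  set w : TangentSpace 𝓘(ℝ, E) (γ s) := mfderivWithin 𝓘(ℝ, ℝ) 𝓘(ℝ, E) γ (Icc 0 t) s (1 : ℝ)
    with hw
  have h6 : derivWithin (y ∘ φ ∘ γ) (Icc 0 t) s = y (chartDeriv φ (γ s) w) := h5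
  rw [h6, ← ofReal_norm, ← ENNReal.ofReal_mul hk, N.norm_eq_chartNorm hφs]
  refine ENNReal.ofReal_le_ofReal ?_
  rw [Real.norm_eq_abs]
  exact (hy2 _).trans (hclose _ hs' _)

/-- The straight segment in the chart is a competitor whose speed is at most `k` times the norm of
`b - a`. -/
theorem edist_symm_le {φ : OpenPartialHomeomorph X E} {x₀ : X} (hφ : IsChartAt φ x₀) {O : Set X}
    {k : ℝ} (hclose : ∀ u ∈ O, ∀ v, N.chartNorm φ u v ≤ k * N.chartNorm φ x₀ v)
    {a b : E} (hab : ∀ z ∈ segment ℝ a b, z ∈ φ.target ∧ φ.symm z ∈ O) :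
    N.edist (φ.symm a) (φ.symm b) ≤ ENNReal.ofReal (k * N.chartNorm φ x₀ (b - a)) := by
  let η : ℝ → E := fun t => a + t • (b - a)
  have hη : ∀ t ∈ Icc (0 : ℝ) 1, η t ∈ segment ℝ a b := fun t ht => by
    rw [segment_eq_image']; exact ⟨t, ht, rfl⟩
  have hηd : ContMDiff 𝓘(ℝ, ℝ) 𝓘(ℝ, E) 1 η := by
    rw [contMDiff_iff_contDiff]; fun_prop
  have hγ : ContMDiffOn 𝓘(ℝ, ℝ) 𝓘(ℝ, E) 1 (φ.symm ∘ η) (Icc 0 1) :=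
    (contMDiffOn_symm_of_mem_maximalAtlas hφ.1).comp hηd.contMDiffOn fun t ht => (hab _ (hη t ht)).1
  have h0 := N.edist_le_pathLength hγ zero_le_one
  have e0 : (φ.symm ∘ η) 0 = φ.symm a := by simp [η]
  have e1 : (φ.symm ∘ η) 1 = φ.symm b := by simp [η]
  rw [e0, e1] at h0
  refine h0.trans ?_
  rw [N.pathLength_eq_lintegral]
  calc _ ≤ ∫⁻ _ in Icc (0 : ℝ) 1, ENNReal.ofReal (k * N.chartNorm φ x₀ (b - a)) := by
        refine MeasureTheory.setLIntegral_mono' measurableSet_Icc fun s hs => ?_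
        obtain ⟨hs1, hs2⟩ := hab _ (hη s hs)
        have hφs : IsChartAt φ (φ.symm (η s)) := hφ.of_mem (φ.map_target hs1)
        have h1 : HasFDerivAt η (ContinuousLinearMap.toSpanSingleton ℝ (b - a)) s := by
          have : HasDerivAt η (b - a) s := by
            simpa [η] using ((hasDerivAt_id s).smul_const (b - a)).const_add a
          exact this.hasFDerivAt
        have h2 := hasMFDerivWithinAt_iff_hasFDerivWithinAt.2 (h1.hasFDerivWithinAt (s := Icc 0 1))
        have h3 : ∀ z, z = η s → HasMFDerivAt 𝓘(ℝ, E) 𝓘(ℝ, E) φ.symm (η s)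
            (mfderiv 𝓘(ℝ, E) 𝓘(ℝ, E) φ.symm z : E →L[ℝ] E) := by
          rintro _ rfl
          exact (mdifferentiableAt_symm_of_mem_maximalAtlas hφ.1 hs1).hasMFDerivAt
        have h4 := (h3 _ (φ.right_inv hs1)).comp_hasMFDerivWithinAt s h2
        have h5 := h4.mfderivWithin
          ((uniqueDiffOn_Icc zero_lt_one s hs).uniqueMDiffWithinAt)
        have h6 : (mfderivWithin 𝓘(ℝ, ℝ) 𝓘(ℝ, E) (φ.symm ∘ η) (Icc 0 1) s (1 : ℝ) : E) =
            chartDerivSymm φ (φ.symm (η s)) (b - a) := by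
          rw [h5]
          change (mfderiv 𝓘(ℝ, E) 𝓘(ℝ, E) φ.symm (φ (φ.symm (η s))) : E →L[ℝ] E)
            (ContinuousLinearMap.toSpanSingleton ℝ (b - a) (1 : ℝ)) = _
          rw [ContinuousLinearMap.toSpanSingleton_apply, one_smul]
          rfl
        refine ENNReal.ofReal_le_ofReal ?_
        refine le_trans (le_of_eq ?_) (hclose _ hs2 (b - a))
        exact congrArg (N.norm (φ.symm (η s))) h6
    _ = _ := by simp

end FinslerStructure

/-! ### Comparison of the Finsler distance with the distance in a chart -/

namespace FinslerStructure

variable {E : Type*} [NormedAddCommGroup E] [NormedSpace ℝ E]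
  {X : Type*} [TopologicalSpace X] [ChartedSpace E X] [IsManifold 𝓘(ℝ, E) 1 X]
  (N : FinslerStructure E X)

theorem exists_nhds_chartNorm_le {φ : OpenPartialHomeomorph X E} {x₀ : X} (hφ : IsChartAt φ x₀)
    {k : ℝ} (hk : 1 < k) : ∃ O ∈ 𝓝 x₀, O ⊆ φ.source ∧ ∀ u ∈ O, ∀ v,
      N.chartNorm φ x₀ v ≤ k * N.chartNorm φ u v ∧ N.chartNorm φ u v ≤ k * N.chartNorm φ x₀ v := by
  obtain ⟨U, hU1, hU2, hU3, hU4⟩ := N.locally_close x₀ φ hφ (k - 1) (by linarith)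
  refine ⟨U, hU1.mem_nhds hU2, hU3, fun u hu v => ?_⟩
  obtain ⟨h1, h2⟩ := hU4 u hu v
  rw [add_sub_cancel, one_div, inv_mul_le_iff₀ (by linarith)] at h1
  rw [add_sub_cancel] at h2
  exact ⟨h1, h2⟩

theorem pball_mem_nhds {φ : OpenPartialHomeomorph X E} {x₀ : X} (hφ : IsChartAt φ x₀) (z : E)
    {r : ℝ} (hr : 0 < r) : {w | N.chartNorm φ x₀ (w - z) < r} ∈ 𝓝 z := by
  refine (isOpen_lt ((N.continuous_chartNorm hφ).comp (by fun_prop : Continuous fun w => w - z))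
    continuous_const).mem_nhds ?_
  simpa using hr

theorem exists_pball_subset {φ : OpenPartialHomeomorph X E} {x₀ : X} (hφ : IsChartAt φ x₀) {z : E}
    {S : Set E} (hS : S ∈ 𝓝 z) : ∃ r > 0, ∀ w, N.chartNorm φ x₀ (w - z) < r → w ∈ S := by
  obtain ⟨m, hm, M, hM, hmM⟩ := N.exists_chartNorm_bounds hφ
  obtain ⟨δ, hδ, hball⟩ := Metric.mem_nhds_iff.1 hS
  refine ⟨m * δ, by positivity, fun w hw => hball ?_⟩
  rw [mem_ball_iff_norm]
  exact lt_of_mul_lt_mul_left ((hmM (w - z)).1.trans_lt hw) hm.le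

/-- Paths that are short in comparison with the size of a chart neighbourhood stay in it. -/
theorem mem_and_seminorm_sub_le_of_pathLength_lt {φ : OpenPartialHomeomorph X E} {x₀ : X}
    (hφ : IsChartAt φ x₀) {C : Set X} (hC : IsClosed C) (hCφ : C ⊆ φ.source) {k : ℝ} (hk : 0 < k)
    (hclose : ∀ u ∈ C, ∀ v, N.chartNorm φ x₀ v ≤ k * N.chartNorm φ u v) {ρ : ℝ}
    (hρ : ∀ z, N.chartNorm φ x₀ (z - φ x₀) < ρ → φ.symm z ∈ interior C)
    {γ : ℝ → X} (hγ : ContMDiff 𝓘(ℝ, ℝ) 𝓘(ℝ, E) 1 γ) (h0 : γ 0 ∈ C) {c : ℝ} (hc : 0 < c)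
    (hcρ : N.chartNorm φ x₀ (φ (γ 0) - φ x₀) + k * c ≤ ρ)
    (hlen : N.pathLength γ 0 1 < ENNReal.ofReal c) :
    γ 1 ∈ C ∧ N.chartNorm φ x₀ (φ (γ 1) - φ (γ 0)) < k * c := by
  have hmove : ∀ t ∈ Icc (0 : ℝ) 1, (∀ s ∈ Icc 0 t, γ s ∈ C) →
      N.chartNorm φ x₀ (φ (γ t) - φ (γ 0)) < k * c := by
    intro t ht hs
    have h1 := N.seminorm_sub_le_pathLength hφ hCφ hk.le hclose ht.1 hγ hs
    have h2 : ENNReal.ofReal k * N.pathLength γ 0 t < ENNReal.ofReal k * ENNReal.ofReal c := by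
      refine (ENNReal.mul_lt_mul_iff_right (by simpa using hk) ENNReal.ofReal_ne_top).2 ?_
      exact (N.pathLength_mono le_rfl ht.2).trans_lt hlen
    rw [← ENNReal.ofReal_mul hk.le] at h2
    exact (ENNReal.ofReal_lt_ofReal_iff (by positivity)).1 (h1.trans_lt h2)
  have hcl : IsClosed (γ ⁻¹' C ∩ Icc 0 1) := (hC.preimage hγ.continuous).inter isClosed_Icc
  have hall : Icc (0 : ℝ) 1 ⊆ γ ⁻¹' C := by
    -- Continuity method: while the path has stayed in `C`, its displacement is too small to leave
    -- the interior of `C`, so it remains in `C` a little longer.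
    refine hcl.Icc_subset_of_forall_mem_nhdsGT_of_Icc_subset h0 ?_
    rintro t ⟨ht0, ht1⟩ htC
    have hmem := htC ⟨ht0, le_rfl⟩
    have h1 := hmove t ⟨ht0, ht1.le⟩ fun s hs => htC hs
    have h2 : φ.symm (φ (γ t)) ∈ interior C := by
      refine hρ _ (lt_of_lt_of_le ?_ hcρ)
      have := map_add_le_add (N.chartNorm φ x₀) (φ (γ t) - φ (γ 0)) (φ (γ 0) - φ x₀)
      rw [sub_add_sub_cancel] at this
      linarith
    rw [φ.left_inv (hCφ hmem)] at h2
    exact hγ.continuous.continuousWithinAt (mem_interior_iff_mem_nhds.1 h2)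
  exact ⟨hall (right_mem_Icc.2 zero_le_one), hmove 1 (right_mem_Icc.2 zero_le_one)
    fun s hs => hall hs⟩

/-- Near `x₀` the Finsler distance is comparable, up to the factor `k`, to the distance in a
chart. -/
theorem exists_edist_comparison [RegularSpace X] {φ : OpenPartialHomeomorph X E} {x₀ : X}
    (hφ : IsChartAt φ x₀) {k : ℝ} (hk : 1 < k) {O : Set X} (hO : O ∈ 𝓝 x₀) :
    ∃ r > 0, (∀ z, N.chartNorm φ x₀ (z - φ x₀) < r → z ∈ φ.target ∧ φ.symm z ∈ O) ∧
      (∀ z z', N.chartNorm φ x₀ (z - φ x₀) < r → N.chartNorm φ x₀ (z' - φ x₀) < r →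
        N.edist (φ.symm z) (φ.symm z') ≤ ENNReal.ofReal (k * N.chartNorm φ x₀ (z - z')) ∧
        ENNReal.ofReal (N.chartNorm φ x₀ (z - z') / k) ≤ N.edist (φ.symm z) (φ.symm z')) ∧
      ∀ z u, N.chartNorm φ x₀ (z - φ x₀) < r → u ∉ O →
        ENNReal.ofReal r ≤ N.edist (φ.symm z) u := by
  obtain ⟨O₁, hO₁, hO₁φ, hclose⟩ := N.exists_nhds_chartNorm_le hφ hk
  -- Regularity of the space enters here: the continuity method needs a closed neighbourhood.
  obtain ⟨C, hC, hCcl, hCO⟩ := exists_mem_nhds_isClosed_subset (inter_mem hO hO₁)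
  have hk0 : 0 < k := by linarith
  have hCφ : C ⊆ φ.source := fun u hu => hO₁φ (hCO hu).2
  have htarget : φ.target ∩ φ.symm ⁻¹' interior C ∈ 𝓝 (φ x₀) := by
    have h1 := φ.map_source hφ.2
    refine inter_mem (φ.open_target.mem_nhds h1) ((φ.continuousAt_symm h1).preimage_mem_nhds ?_)
    rw [φ.left_inv hφ.2]
    exact interior_mem_nhds.2 hC
  obtain ⟨ρ, hρ, hρball⟩ := N.exists_pball_subset hφ htarget
  set p := N.chartNorm φ x₀ with hp
  -- Chosen so that `r + 2 k r = ρ`: a path starting in the `r`-ball with displacement at most `2 k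
  -- r` stays in the `ρ`-ball.
  set r := ρ / (1 + 2 * k) with hr
  have hr0 : 0 < r := by positivity
  have hrρ : r + 2 * (k * r) = ρ := by rw [hr]; field_simp
  have hkr : 0 < k * r := by positivity
  have hkr' : r < k * r := by nlinarith
  have hstay : ∀ z u, p (z - φ x₀) < r → ∀ c, 0 < c → k * c ≤ 2 * (k * r) →
      N.edist (φ.symm z) u < ENNReal.ofReal c → u ∈ C ∧ p (φ u - z) < k * c := by
    intro z u hz c hc hck hlt
    obtain ⟨γ, hγ0, hγ1, hγ, hlen⟩ := N.exists_path_of_edist_lt hlt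
    obtain ⟨hzt, hzC⟩ := hρball z (by linarith)
    have hz0 : φ (γ 0) = z := by rw [hγ0, φ.right_inv hzt]
    have := N.mem_and_seminorm_sub_le_of_pathLength_lt hφ hCcl hCφ hk0
      (fun u hu v => (hclose u (hCO hu).2 v).1) (fun z hz => (hρball z hz).2) hγ
      (by rw [hγ0]; exact interior_subset hzC) hc (by rw [hz0]; linarith) hlen
    rwa [hz0, hγ1] at this
  refine ⟨r, hr0, fun z hz => ?_, fun z z' hz hz' => ⟨?_, ?_⟩, fun z u hz hu => ?_⟩
  · obtain ⟨h1, h2⟩ := hρball z (by linarith)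
    exact ⟨h1, (hCO (interior_subset h2)).1⟩
  · rw [N.edist_comm]
    refine N.edist_symm_le hφ (O := O₁) (fun u hu v => (hclose u hu v).2) fun w hw => ?_
    have hconv : Convex ℝ (p.ball (φ x₀) r) := p.convex_ball _ _
    have h1 := hconv.segment_subset ((p.mem_ball).2 hz') ((p.mem_ball).2 hz) hw
    rw [Seminorm.mem_ball] at h1
    obtain ⟨h2, h3⟩ := hρball w (by linarith)
    exact ⟨h2, (hCO (interior_subset h3)).2⟩
  · by_contra! hlt
    obtain ⟨c, hc0, hc1, hc2⟩ := ENNReal.lt_iff_exists_real_btwn.1 hlt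
    have hc3 := (ENNReal.ofReal_lt_ofReal_iff_of_nonneg hc0).1 hc2
    rw [lt_div_iff₀ hk0] at hc3
    have hcpos : 0 < c := by
      by_contra! h
      rw [ENNReal.ofReal_of_nonpos h] at hc1
      exact absurd hc1 (by simp)
    have hzz : p (z - z') < 2 * r := by
      have := map_sub_le_add p (z - φ x₀) (z' - φ x₀)
      rw [sub_sub_sub_cancel_right] at this
      linarith
    obtain ⟨-, h2⟩ := hstay z _ hz c hcpos (by linarith) hc1
    rw [φ.right_inv (hρball z' (by linarith)).1, map_sub_rev] at h2
    linarith
  · by_contra! hlt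
    exact hu (hCO (hstay z u hz r hr0 (by linarith) hlt).1).1

/-- The points at finite distance from `x` form a clopen set, because nearby points are at finite
distance from each other. -/
theorem edist_ne_top [RegularSpace X] [PreconnectedSpace X] (x y : X) : N.edist x y ≠ ⊤ := by
  have hloc : ∀ y : X, ∀ᶠ z in 𝓝 y, N.edist y z ≠ ⊤ := by
    intro y
    have hφ : IsChartAt (chartAt E y) y :=
      ⟨IsManifold.chart_mem_maximalAtlas y, mem_chart_source E y⟩
    obtain ⟨r, hr, -, h2, -⟩ := N.exists_edist_comparison hφ one_lt_two univ_mem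
    filter_upwards [((chartAt E y).continuousAt hφ.2).preimage_mem_nhds
      (N.pball_mem_nhds hφ _ hr), (chartAt E y).open_source.mem_nhds hφ.2] with z hz hzs
    have := (h2 (chartAt E y y) _ (by simpa using hr) hz).1
    rw [(chartAt E y).left_inv hφ.2, (chartAt E y).left_inv hzs] at this
    exact ne_top_of_le_ne_top ENNReal.ofReal_ne_top this
  have hclopen : IsClopen {z | N.edist x z ≠ ⊤} := by
    constructor
    · rw [← isOpen_compl_iff, isOpen_iff_mem_nhds]
      intro z hz
      filter_upwards [hloc z] with w hw hxw
      refine hz (ne_top_of_le_ne_top (ENNReal.add_ne_top.2 ⟨hxw, ?_⟩) (N.edist_triangle x w z))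
      rwa [N.edist_comm]
    · rw [isOpen_iff_mem_nhds]
      intro z hz
      filter_upwards [hloc z] with w hw
      exact ne_top_of_le_ne_top (ENNReal.add_ne_top.2 ⟨hz, hw⟩) (N.edist_triangle x z w)
  have huniv := hclopen.eq_univ ⟨x, by rw [mem_ofPred_eq, N.edist_self]; simp⟩
  exact (huniv ▸ mem_univ y : y ∈ {z | N.edist x z ≠ ⊤})

theorem dist_comm (x y : X) : N.dist x y = N.dist y x := by
  rw [FinslerStructure.dist, N.edist_comm, FinslerStructure.dist]

theorem dist_nonneg (x y : X) : 0 ≤ N.dist x y := ENNReal.toReal_nonneg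

theorem dist_self (x : X) : N.dist x x = 0 := by
  rw [FinslerStructure.dist, N.edist_self, ENNReal.toReal_zero]

variable [RegularSpace X] [PreconnectedSpace X]

theorem ofReal_dist (x y : X) : ENNReal.ofReal (N.dist x y) = N.edist x y :=
  ENNReal.ofReal_toReal (N.edist_ne_top x y)

theorem dist_triangle (x y z : X) : N.dist x z ≤ N.dist x y + N.dist y z := by
  rw [FinslerStructure.dist, FinslerStructure.dist, FinslerStructure.dist,
    ← ENNReal.toReal_add (N.edist_ne_top _ _) (N.edist_ne_top _ _)]
  exact ENNReal.toReal_mono (ENNReal.add_ne_top.2 ⟨N.edist_ne_top _ _, N.edist_ne_top _ _⟩)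
    (N.edist_triangle x y z)

theorem exists_dist_comparison {φ : OpenPartialHomeomorph X E} {x₀ : X}
    (hφ : IsChartAt φ x₀) {k : ℝ} (hk : 1 < k) {O : Set X} (hO : O ∈ 𝓝 x₀) :
    ∃ r > 0, (∀ z, N.chartNorm φ x₀ (z - φ x₀) < r → z ∈ φ.target ∧ φ.symm z ∈ O) ∧
      (∀ z z', N.chartNorm φ x₀ (z - φ x₀) < r → N.chartNorm φ x₀ (z' - φ x₀) < r →
        N.dist (φ.symm z) (φ.symm z') ≤ k * N.chartNorm φ x₀ (z - z') ∧
        N.chartNorm φ x₀ (z - z') ≤ k * N.dist (φ.symm z) (φ.symm z')) ∧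
      ∀ z u, N.chartNorm φ x₀ (z - φ x₀) < r → u ∉ O → r ≤ N.dist (φ.symm z) u := by
  obtain ⟨r, hr, h1, h2, h3⟩ := N.exists_edist_comparison hφ hk hO
  have hk0 : 0 < k := by linarith
  refine ⟨r, hr, h1, fun z z' hz hz' => ?_, fun z u hz hu => ?_⟩
  · obtain ⟨h4, h5⟩ := h2 z z' hz hz'
    rw [← N.ofReal_dist, ENNReal.ofReal_le_ofReal_iff
      (mul_nonneg hk0.le (apply_nonneg _ _))] at h4
    rw [← N.ofReal_dist, ENNReal.ofReal_le_ofReal_iff (N.dist_nonneg _ _),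
      div_le_iff₀' hk0] at h5
    exact ⟨h4, h5⟩
  · have h4 := h3 z u hz hu
    rwa [← N.ofReal_dist, ENNReal.ofReal_le_ofReal_iff (N.dist_nonneg _ _)] at h4

theorem ball_mem_nhds (x : X) {r : ℝ} (hr : 0 < r) : N.ball x r ∈ 𝓝 x := by
  have hφ : IsChartAt (chartAt E x) x :=
    ⟨IsManifold.chart_mem_maximalAtlas x, mem_chart_source E x⟩
  obtain ⟨s, hs, -, h2, -⟩ := N.exists_dist_comparison hφ one_lt_two univ_mem
  filter_upwards [((chartAt E x).continuousAt hφ.2).preimage_mem_nhds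
    (N.pball_mem_nhds hφ _ (lt_min hs (half_pos hr))),
    (chartAt E x).open_source.mem_nhds hφ.2] with z hz hzs
  have hz' := lt_min_iff.1 (mem_ofPred_eq ▸ hz : _ < min s (r / 2))
  have := (h2 _ (chartAt E x x) hz'.1 (by simpa using hs)).1
  rw [(chartAt E x).left_inv hφ.2, (chartAt E x).left_inv hzs] at this
  change N.dist z x < r
  linarith [hz'.2]

theorem exists_ball_subset {x : X} {O : Set X} (hO : O ∈ 𝓝 x) : ∃ r > 0, N.ball x r ⊆ O := by
  have hφ : IsChartAt (chartAt E x) x :=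
    ⟨IsManifold.chart_mem_maximalAtlas x, mem_chart_source E x⟩
  obtain ⟨s, hs, -, -, h3⟩ := N.exists_dist_comparison hφ one_lt_two hO
  refine ⟨s, hs, fun u hu => ?_⟩
  by_contra hnot
  have := h3 (chartAt E x x) u (by simpa using hs) hnot
  rw [(chartAt E x).left_inv hφ.2, N.dist_comm] at this
  exact absurd hu (not_lt.2 this)

end FinslerStructure

/-! ### Change of charts and the hulls of the operators -/

section Transition

variable {E : Type*} [NormedAddCommGroup E] [NormedSpace ℝ E]
  {X : Type*} [TopologicalSpace X] [ChartedSpace E X]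

/-- The differential of the chart transition `φ ∘ φ'⁻¹` at the image of `u`. -/
def chartTransition (φ φ' : OpenPartialHomeomorph X E) (u : X) : E →L[ℝ] E :=
  chartDeriv φ u ∘L chartDerivSymm φ' u

theorem IsChartAt.contDiffAt_comp_symm {φ φ' : OpenPartialHomeomorph X E} {u : X}
    (hφ : IsChartAt φ u) (hφ' : IsChartAt φ' u) : ContDiffAt ℝ 1 (φ ∘ φ'.symm) (φ' u) := by
  rw [← contMDiffAt_iff_contDiffAt]
  refine ContMDiffAt.comp (φ' u) ?_
    (contMDiffAt_symm_of_mem_maximalAtlas hφ'.1 (φ'.map_source hφ'.2))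
  rw [φ'.left_inv hφ'.2]
  exact contMDiffAt_of_mem_maximalAtlas hφ.1 hφ.2

theorem IsChartAt.continuousAt_chartTransition {φ φ' : OpenPartialHomeomorph X E} {u : X}
    (hφ : IsChartAt φ u) (hφ' : IsChartAt φ' u) :
    ContinuousAt (chartTransition φ φ') u := by
  have h1 : ContinuousAt (fderiv ℝ (φ ∘ φ'.symm)) (φ' u) :=
    ((hφ.contDiffAt_comp_symm hφ').fderiv_right (m := 0) (by simp)).continuousAt
  refine (h1.comp (φ'.continuousAt hφ'.2)).congr ?_
  filter_upwards [φ.open_source.mem_nhds hφ.2, φ'.open_source.mem_nhds hφ'.2] with w hw hw'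
  exact ((hφ.of_mem hw).hasFDerivAt_comp_symm (hφ'.of_mem hw')).fderiv

theorem IsChartAt.chartTransition_comp {φ φ' : OpenPartialHomeomorph X E} {u : X}
    (hφ : IsChartAt φ u) (hφ' : IsChartAt φ' u) :
    chartTransition φ φ' u ∘L chartTransition φ' φ u = ContinuousLinearMap.id ℝ E := by
  ext v
  change chartDeriv φ u (chartDerivSymm φ' u (chartDeriv φ' u (chartDerivSymm φ u v))) = v
  rw [hφ'.chartDerivSymm_chartDeriv, hφ.chartDeriv_chartDerivSymm]

end Transition

section NormedSpaces

variable {E F : Type*} [NormedAddCommGroup E] [NormedSpace ℝ E]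
  [NormedAddCommGroup F] [NormedSpace ℝ F]

/-- Write `B T A - T = (B - 1) T A + T (A - 1)` and use `‖A‖ ≤ 2`. -/
theorem norm_comp_comp_sub_le {T : E →L[ℝ] F} {A : E →L[ℝ] E} {B : F →L[ℝ] F} {K η : ℝ}
    (hT : ‖T‖ ≤ K) (hη : η ≤ 1) (hA : ‖A - ContinuousLinearMap.id ℝ E‖ ≤ η)
    (hB : ‖B - ContinuousLinearMap.id ℝ F‖ ≤ η) : ‖B ∘L T ∘L A - T‖ ≤ 3 * K * η := by
  have hη0 : 0 ≤ η := (norm_nonneg _).trans hA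
  have hK0 : 0 ≤ K := (norm_nonneg _).trans hT
  have hA2 : ‖A‖ ≤ 2 := by
    have h1 : ‖A‖ ≤ ‖A - ContinuousLinearMap.id ℝ E‖ + ‖ContinuousLinearMap.id ℝ E‖ := by
      simpa using norm_add_le (A - ContinuousLinearMap.id ℝ E) (ContinuousLinearMap.id ℝ E)
    have h2 := ContinuousLinearMap.norm_id_le (𝕜 := ℝ) (E := E)
    linarith
  have h1 : B ∘L T ∘L A - T = (B - ContinuousLinearMap.id ℝ F) ∘L (T ∘L A) +
      T ∘L (A - ContinuousLinearMap.id ℝ E) := by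
    ext v; simp
  rw [h1]
  calc _ ≤ ‖B - ContinuousLinearMap.id ℝ F‖ * (‖T‖ * ‖A‖) +
        ‖T‖ * ‖A - ContinuousLinearMap.id ℝ E‖ := by
        refine (norm_add_le _ _).trans (add_le_add ?_ (ContinuousLinearMap.opNorm_comp_le _ _))
        refine (ContinuousLinearMap.opNorm_comp_le _ _).trans ?_
        gcongr
        exact ContinuousLinearMap.opNorm_comp_le _ _
    _ ≤ η * (K * 2) + K * η := by gcongr
    _ = _ := by ring

/-- The `ε`-neighbourhood of a convex set is convex, so an approximation of generators extends to
their hull. -/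
theorem exists_norm_sub_le_of_mem_convexHull {V : Type*} [AddCommGroup V] [Module ℝ V]
    {W : Type*} [SeminormedAddCommGroup W] [NormedSpace ℝ W] {G : Set V} {H : Set W}
    (hH : Convex ℝ H) (L : V →ₗ[ℝ] W) {ε : ℝ} (h : ∀ S ∈ G, ∃ T ∈ H, ‖L S - T‖ ≤ ε) :
    ∀ S ∈ convexHull ℝ G, ∃ T ∈ H, ‖L S - T‖ ≤ ε := by
  refine convexHull_min (t := {S | ∃ T ∈ H, ‖L S - T‖ ≤ ε}) h ?_
  rintro S₁ ⟨T₁, hT₁, h₁⟩ S₂ ⟨T₂, hT₂, h₂⟩ a b ha hb hab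
  refine ⟨a • T₁ + b • T₂, hH hT₁ hT₂ ha hb hab, ?_⟩
  have : L (a • S₁ + b • S₂) - (a • T₁ + b • T₂) = a • (L S₁ - T₁) + b • (L S₂ - T₂) := by
    rw [map_add, map_smul, map_smul, smul_sub, smul_sub]; abel
  rw [this]
  calc _ ≤ a * ‖L S₁ - T₁‖ + b * ‖L S₂ - T₂‖ := by
        refine (norm_add_le _ _).trans (le_of_eq ?_)
        rw [norm_smul, norm_smul, Real.norm_of_nonneg ha, Real.norm_of_nonneg hb]
    _ ≤ a * ε + b * ε := by gcongr
    _ = ε := by rw [← add_mul, hab, one_mul]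

end NormedSpaces

section LocalHull

variable {E F : Type*} [NormedAddCommGroup E] [NormedSpace ℝ E]
  [NormedAddCommGroup F] [NormedSpace ℝ F] {X : Type*} [TopologicalSpace X]

/-- The operators `T ∈ J(φ(w))`, `w ∈ O`, and their convex combinations. -/
def localHull (J : E → Set (E →L[ℝ] F)) (φ : OpenPartialHomeomorph X E) (O : Set X) :
    Set (E →L[ℝ] F) :=
  convexHull ℝ (⋃ w ∈ O, J (φ w))

theorem localHull_mono (J : E → Set (E →L[ℝ] F)) (φ : OpenPartialHomeomorph X E) {O O' : Set X}
    (h : O ⊆ O') : localHull J φ O ⊆ localHull J φ O' :=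
  convexHull_mono (biUnion_subset_biUnion_left h)

end LocalHull

section Comparison

variable {E F : Type*} [NormedAddCommGroup E] [NormedSpace ℝ E]
  [NormedAddCommGroup F] [NormedSpace ℝ F]
  {X : Type*} [TopologicalSpace X] [ChartedSpace E X]
  {Y : Type*} [TopologicalSpace Y] [ChartedSpace F Y]

/-- The representative in `𝓛(E, F)` of an operator between tangent spaces. -/
def chartRep (φ : OpenPartialHomeomorph X E) (ψ : OpenPartialHomeomorph Y F) (u : X) (y : Y) :
    (TangentSpace 𝓘(ℝ, E) u →L[ℝ] TangentSpace 𝓘(ℝ, F) y) →ₗ[ℝ] (E →L[ℝ] F) where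
  toFun S := chartDeriv ψ y ∘L S ∘L chartDerivSymm φ u
  map_add' S T := by
    ext v
    exact map_add (chartDeriv ψ y) _ _
  map_smul' c S := by
    ext v
    exact map_smul (chartDeriv ψ y) _ _

variable {f : X → Y} {Jf : OperatorFamily E F f} {φ φ' : OpenPartialHomeomorph X E}
  {ψ ψ' : OpenPartialHomeomorph Y F} {J : E → Set (E →L[ℝ] F)} {u : X}

/-- The representative is `B T A`, where `A` and `B` are products of transition differentials at `w`
and at `u`. The transitions are `C^1`, so `A` and `B` tend to the identity as `w → u`, and `T`
ranges over a bounded set. -/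
theorem eventually_norm_chartRep_transport_sub_le (hφ : IsChartAt φ u) (hψ : IsChartAt ψ (f u))
    (hφ' : IsChartAt φ' u) (hψ' : IsChartAt ψ' (f u)) (hf : ContinuousAt f u)
    (hJ : IsLocallyBoundedOn J φ.target) {ε : ℝ} (hε : 0 < ε) :
    ∀ᶠ w in 𝓝 u, ∀ T ∈ J (φ w), ‖chartRep φ ψ u (f u) (transportOperator f φ' ψ' u w
      (chartDerivSymm ψ (f w) ∘L T ∘L chartDeriv φ w)) - T‖ ≤ ε := by
  obtain ⟨R, hR, -, hbdd⟩ := hJ (φ u) (φ.map_source hφ.2)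
  obtain ⟨K, hK⟩ := hbdd.exists_norm_le
  set η := min 1 (ε / (3 * (|K| + 1))) with hη
  have hη0 : 0 < η := by positivity
  have hA : Tendsto (fun w => chartTransition φ φ' w ∘L chartTransition φ' φ u) (𝓝 u)
      (𝓝 (ContinuousLinearMap.id ℝ E)) := by
    rw [← hφ.chartTransition_comp hφ']
    exact ((hφ.continuousAt_chartTransition hφ').clm_comp continuousAt_const)
  have hB : Tendsto (fun w => chartTransition ψ ψ' (f u) ∘L chartTransition ψ' ψ (f w)) (𝓝 u)
      (𝓝 (ContinuousLinearMap.id ℝ F)) := by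
    rw [← hψ.chartTransition_comp hψ']
    exact ContinuousAt.clm_comp continuousAt_const
      ((hψ'.continuousAt_chartTransition hψ).comp hf)
  filter_upwards [hA (Metric.closedBall_mem_nhds _ hη0), hB (Metric.closedBall_mem_nhds _ hη0),
    (φ.continuousAt hφ.2) (Metric.ball_mem_nhds _ hR)] with w hwA hwB hw T hT
  rw [mem_preimage, mem_closedBall_iff_norm] at hwA hwB
  have hTK : ‖T‖ ≤ |K| := (hK T (mem_iUnion₂.2 ⟨φ w, hw, hT⟩)).trans (le_abs_self K)
  have h1 := norm_comp_comp_sub_le hTK (min_le_left _ _) hwA hwB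
  refine le_trans (le_of_eq ?_) (h1.trans ?_)
  · rfl
  · calc 3 * |K| * η ≤ 3 * |K| * (ε / (3 * (|K| + 1))) := by
          gcongr; exact min_le_right _ _
      _ = ε * (|K| / (|K| + 1)) := by field_simp
      _ ≤ ε * 1 := by
          gcongr
          rw [div_le_one (by positivity)]
          linarith
      _ = ε := mul_one _

variable [IsManifold 𝓘(ℝ, E) 1 X] [RegularSpace X] [PreconnectedSpace X]
  (N : FinslerStructure E X)

/-- With `exists_mem_coJacobian_of_mem_localHull`, this makes the hull independent of the charts up
to `ε`, which is enough because expanding isomorphisms are stable. -/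
theorem exists_mem_localHull_of_mem_coJacobian (hrep : IsRepresentedBy f Jf φ ψ J)
    (hφ : IsChartAt φ u) (hψ : IsChartAt ψ (f u))
    (hφ' : IsChartAt φ' u) (hψ' : IsChartAt ψ' (f u)) (hf : ContinuousAt f u)
    {O : Set X} (hO : O ∈ 𝓝 u) {ε : ℝ} (hε : 0 < ε) :
    ∃ R > 0, ∀ S ∈ coJacobian N f Jf φ' ψ' u R,
      ∃ T ∈ localHull J φ O, ‖chartRep φ ψ u (f u) S - T‖ ≤ ε := by
  obtain ⟨R, hR, hball⟩ := N.exists_ball_subset (inter_mem (inter_mem hO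
    (φ.open_source.mem_nhds hφ.2))
    (eventually_norm_chartRep_transport_sub_le hφ hψ hφ' hψ' hf hrep.2.2.1 hε))
  refine ⟨R, hR, exists_norm_sub_le_of_mem_convexHull (convex_convexHull ℝ _) _ ?_⟩
  rintro _ ⟨w, hw, -, -, T', hT', rfl⟩
  obtain ⟨⟨hwO, hwφ⟩, hwT⟩ := hball hw
  rw [hrep.2.2.2 w hwφ] at hT'
  obtain ⟨T, hT, rfl⟩ := hT'
  exact ⟨T, subset_convexHull ℝ _ (mem_iUnion₂.2 ⟨w, hwO, hT⟩), hwT T hT⟩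

theorem exists_mem_coJacobian_of_mem_localHull (hrep : IsRepresentedBy f Jf φ ψ J)
    (hφ : IsChartAt φ u) (hψ : IsChartAt ψ (f u))
    (hφ' : IsChartAt φ' u) (hψ' : IsChartAt ψ' (f u)) (hf : ContinuousAt f u)
    {R : ℝ} (hR : 0 < R) {ε : ℝ} (hε : 0 < ε) :
    ∃ O ∈ 𝓝 u, ∀ T ∈ localHull J φ O,
      ∃ S ∈ coJacobian N f Jf φ' ψ' u R, ‖chartRep φ ψ u (f u) S - T‖ ≤ ε := by
  refine ⟨_, inter_mem (inter_mem (N.ball_mem_nhds u hR) (φ.open_source.mem_nhds hφ.2))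
    (inter_mem (inter_mem (φ'.open_source.mem_nhds hφ'.2)
      (hf.preimage_mem_nhds (ψ'.open_source.mem_nhds hψ'.2)))
      (eventually_norm_chartRep_transport_sub_le hφ hψ hφ' hψ' hf hrep.2.2.1 hε)), ?_⟩
  suffices h : ∀ T ∈ localHull J φ _, ∃ T' ∈ chartRep φ ψ u (f u) '' coJacobian N f Jf φ' ψ' u R,
      ‖(LinearMap.id : (E →L[ℝ] F) →ₗ[ℝ] (E →L[ℝ] F)) T - T'‖ ≤ ε by
    intro T hT
    obtain ⟨_, ⟨S, hS, rfl⟩, hle⟩ := h T hT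
    exact ⟨S, hS, by rwa [norm_sub_rev]⟩
  refine exists_norm_sub_le_of_mem_convexHull ((convex_convexHull ℝ _).linear_image _) _ ?_
  intro T hT
  simp only [mem_iUnion] at hT
  obtain ⟨w, ⟨⟨hwR, hwφ⟩, ⟨hwφ', hwψ'⟩, hwT⟩, hT⟩ := hT
  have hmem : chartDerivSymm ψ (f w) ∘L T ∘L chartDeriv φ w ∈ Jf w := by
    rw [hrep.2.2.2 w hwφ]
    exact ⟨T, hT, rfl⟩
  exact ⟨_, ⟨_, subset_convexHull ℝ _ ⟨w, hwR, hwφ', hwψ', _, hmem, rfl⟩, rfl⟩,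
    (norm_sub_rev _ _).trans_le (hwT T hT)⟩

end Comparison

/-! ### Locally Lipschitz maps in arbitrary charts -/

section Lipschitz

variable {E F : Type*} [NormedAddCommGroup E] [NormedSpace ℝ E]
  [NormedAddCommGroup F] [NormedSpace ℝ F]
  {X : Type*} [TopologicalSpace X] [ChartedSpace E X]
  {Y : Type*} [TopologicalSpace Y] [ChartedSpace F Y] {f : X → Y}

theorem IsLocallyLipschitz.continuous (hf : IsLocallyLipschitz (E := E) (F := F) f) :
    Continuous f := by
  rw [continuous_iff_continuousAt]
  intro x
  obtain ⟨φ, ψ, K, hφ, hψ, hmaps, hK⟩ := hf x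
  have h1 : ContinuousAt (ψ ∘ f ∘ φ.symm) (φ x) :=
    hK.continuousOn.continuousAt (φ.open_target.mem_nhds (φ.map_source hφ.2))
  have h2 : ContinuousAt ((ψ ∘ f ∘ φ.symm) ∘ φ) x := h1.comp (φ.continuousAt hφ.2)
  have h3 : ((ψ ∘ f ∘ φ.symm) ∘ φ) x = ψ (f x) := by
    simp [φ.left_inv hφ.2]
  have h4 : ContinuousAt ψ.symm (((ψ ∘ f ∘ φ.symm) ∘ φ) x) := by
    rw [h3]
    exact ψ.continuousAt_symm (ψ.map_source hψ.2)
  refine (h4.comp h2).congr ?_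
  filter_upwards [φ.open_source.mem_nhds hφ.2] with w hw
  simp [φ.left_inv hw, ψ.left_inv (hmaps hw)]

/-- The chart transitions are `C^1`, hence locally Lipschitz, so the charts supplied by the
definition can be exchanged for any others. -/
theorem IsLocallyLipschitz.exists_lipschitzOnWith (hf : IsLocallyLipschitz (E := E) (F := F) f)
    {x : X} {φ : OpenPartialHomeomorph X E} {ψ : OpenPartialHomeomorph Y F}
    (hφ : IsChartAt φ x) (hψ : IsChartAt ψ (f x)) :
    ∃ (L : NNReal) (s : Set E), s ∈ 𝓝 (φ x) ∧ LipschitzOnWith L (ψ ∘ f ∘ φ.symm) s := by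
  obtain ⟨φ₁, ψ₁, K, hφ₁, hψ₁, hmaps, hK⟩ := hf x
  obtain ⟨K₁, s₁, hs₁, hK₁⟩ := (hφ₁.contDiffAt_comp_symm hφ).exists_lipschitzOnWith
  obtain ⟨K₂, s₂, hs₂, hK₂⟩ := (hψ.contDiffAt_comp_symm hψ₁).exists_lipschitzOnWith
  have hxt := φ.map_source hφ.2
  have hc : ContinuousAt φ.symm (φ x) := φ.continuousAt_symm hxt
  have hsource : φ.symm ⁻¹' φ₁.source ∈ 𝓝 (φ x) := by
    refine hc.preimage_mem_nhds ?_
    rw [φ.left_inv hφ.2]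
    exact φ₁.open_source.mem_nhds hφ₁.2
  have hs₂' : (fun z => ψ₁ (f (φ.symm z))) ⁻¹' s₂ ∈ 𝓝 (φ x) := by
    have h1 : ContinuousAt (fun z => ψ₁ (f (φ.symm z))) (φ x) := by
      refine ContinuousAt.comp (g := ψ₁) ?_ (hf.continuous.continuousAt.comp hc)
      simp only [φ.left_inv hφ.2]
      exact ψ₁.continuousAt hψ₁.2
    refine h1.preimage_mem_nhds ?_
    simp only [φ.left_inv hφ.2]
    exact hs₂
  refine ⟨K₂ * (K * K₁), s₁ ∩ φ.symm ⁻¹' φ₁.source ∩ (fun z => ψ₁ (f (φ.symm z))) ⁻¹' s₂,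
    inter_mem (inter_mem hs₁ hsource) hs₂', ?_⟩
  have h1 : LipschitzOnWith (K₂ * (K * K₁))
      ((ψ ∘ ψ₁.symm) ∘ (ψ₁ ∘ f ∘ φ₁.symm) ∘ (φ₁ ∘ φ.symm))
      (s₁ ∩ φ.symm ⁻¹' φ₁.source ∩ (fun z => ψ₁ (f (φ.symm z))) ⁻¹' s₂) := by
    refine hK₂.comp (hK.comp (hK₁.mono fun z hz => hz.1.1) ?_) ?_
    · exact fun z hz => φ₁.map_source hz.1.2
    · intro z hz
      simp only [Function.comp_apply, φ₁.left_inv hz.1.2]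
      exact hz.2
  have heq : ∀ z ∈ s₁ ∩ φ.symm ⁻¹' φ₁.source ∩ (fun z => ψ₁ (f (φ.symm z))) ⁻¹' s₂,
      ((ψ ∘ ψ₁.symm) ∘ (ψ₁ ∘ f ∘ φ₁.symm) ∘ (φ₁ ∘ φ.symm)) z = (ψ ∘ f ∘ φ.symm) z := fun z hz => by
    simp only [Function.comp_apply]
    rw [φ₁.left_inv hz.1.2, ψ₁.left_inv (hmaps hz.1.2)]
  intro z hz w hw
  rw [← heq z hz, ← heq w hw]
  exact h1 hz hw

end Lipschitz

/-! ### Regularity and the two indices -/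

section Regularity

variable {E F : Type*} [NormedAddCommGroup E] [NormedSpace ℝ E]
  [NormedAddCommGroup F] [NormedSpace ℝ F]
  {X : Type*} [TopologicalSpace X] [ChartedSpace E X]
  {Y : Type*} [TopologicalSpace Y] [ChartedSpace F Y]

theorem chartRep_bijective_iff {φ : OpenPartialHomeomorph X E} {ψ : OpenPartialHomeomorph Y F}
    {u : X} {y : Y} (hφ : IsChartAt φ u) (hψ : IsChartAt ψ y)
    (S : TangentSpace 𝓘(ℝ, E) u →L[ℝ] TangentSpace 𝓘(ℝ, F) y) :
    Function.Bijective (chartRep φ ψ u y S) ↔ Function.Bijective S := by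
  have h : (chartRep φ ψ u y S : E → F) = hψ.derivEquiv ∘ S ∘ hφ.derivEquiv.symm := rfl
  rw [h]
  constructor
  · intro hb
    have := (hψ.derivEquiv.symm.bijective.comp hb).comp hφ.derivEquiv.bijective
    convert! this using 1
    ext v
    simp
  · intro hb
    exact hψ.derivEquiv.bijective.comp (hb.comp hφ.derivEquiv.symm.bijective)

/-- The open mapping theorem, applied to the representative between the model Banach spaces. -/
theorem exists_continuousLinearEquiv_of_bijective [CompleteSpace E] [CompleteSpace F]
    {φ : OpenPartialHomeomorph X E}
    {ψ : OpenPartialHomeomorph Y F} {u : X} {y : Y} (hφ : IsChartAt φ u) (hψ : IsChartAt ψ y)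
    {S : TangentSpace 𝓘(ℝ, E) u →L[ℝ] TangentSpace 𝓘(ℝ, F) y} (hS : Function.Bijective S) :
    ∃ e : TangentSpace 𝓘(ℝ, E) u ≃L[ℝ] TangentSpace 𝓘(ℝ, F) y,
      (e : TangentSpace 𝓘(ℝ, E) u →L[ℝ] TangentSpace 𝓘(ℝ, F) y) = S := by
  have hb := (chartRep_bijective_iff hφ hψ S).2 hS
  set e₀ := ContinuousLinearEquiv.ofBijective (chartRep φ ψ u y S) (LinearMap.ker_eq_bot.2 hb.1)
    (LinearMap.range_eq_top.2 hb.2)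
  refine ⟨(hφ.derivEquiv.trans e₀).trans hψ.derivEquiv.symm, ?_⟩
  ext v
  change chartDerivSymm ψ y (chartDeriv ψ y (S (chartDerivSymm φ u (chartDeriv φ u v)))) = S v
  rw [hψ.chartDerivSymm_chartDeriv, hφ.chartDerivSymm_chartDeriv]

instance (u : X) : LocallyConvexSpace ℝ (TangentSpace 𝓘(ℝ, E) u) :=
  inferInstanceAs (LocallyConvexSpace ℝ E)


theorem FinslerStructure.exists_abs_le_mul_norm [IsManifold 𝓘(ℝ, F) 1 Y]
    (N' : FinslerStructure F Y) (y : Y) (ℓ : TangentSpace 𝓘(ℝ, F) y →L[ℝ] ℝ) :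
    ∃ D, ∀ w, |ℓ w| ≤ D * N'.norm y w := by
  have hψ : IsChartAt (chartAt F y) y :=
    ⟨IsManifold.chart_mem_maximalAtlas y, mem_chart_source F y⟩
  obtain ⟨m, hm, M, hM, hmM⟩ := N'.exists_chartNorm_bounds hψ
  set ξ : F →L[ℝ] ℝ := ℓ ∘L chartDerivSymm (chartAt F y) y with hξ
  refine ⟨‖ξ‖ / m, fun w => ?_⟩
  have h1 : ℓ w = ξ (chartDeriv (chartAt F y) y w) :=
    congrArg ℓ (hψ.chartDerivSymm_chartDeriv w).symm
  rw [h1, N'.norm_eq_chartNorm hψ, div_mul_eq_mul_div, le_div_iff₀ hm]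
  have h2 := ξ.le_opNorm (chartDeriv (chartAt F y) y w)
  have h3 := (hmM (chartDeriv (chartAt F y) y w)).1
  rw [Real.norm_eq_abs] at h2
  have h4 := norm_nonneg ξ
  calc _ ≤ ‖ξ‖ * ‖chartDeriv (chartAt F y) y w‖ * m := by gcongr
    _ = ‖ξ‖ * (m * ‖chartDeriv (chartAt F y) y w‖) := by ring
    _ ≤ _ := by gcongr

variable [IsManifold 𝓘(ℝ, E) 1 X] {N : FinslerStructure E X} {f : X → Y} {Jf : OperatorFamily E F f}

theorem coJacobian_mono (φ : OpenPartialHomeomorph X E) (ψ : OpenPartialHomeomorph Y F) (x : X)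
    {R R' : ℝ} (h : R ≤ R') : coJacobian N f Jf φ ψ x R ⊆ coJacobian N f Jf φ ψ x R' := by
  refine convexHull_mono ?_
  rintro S ⟨u, hu, hS⟩
  exact ⟨u, lt_of_lt_of_le hu h, hS⟩

variable [CompleteSpace E] [CompleteSpace F]

variable [IsManifold 𝓘(ℝ, F) 1 Y] {N' : FinslerStructure F Y}

/-- The operators of `co J` near a regular point are isomorphisms which expand by a factor
`κ > α`. -/
theorem IsJacobianRegularAt.exists_localHull [RegularSpace X] [PreconnectedSpace X]
    {φ φ' : OpenPartialHomeomorph X E} {ψ ψ' : OpenPartialHomeomorph Y F}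
    {J : E → Set (E →L[ℝ] F)} {x : X}
    (hreg : IsJacobianRegularAt N N' f Jf φ' ψ' x) (hrep : IsRepresentedBy f Jf φ ψ J)
    (hφ : IsChartAt φ x) (hψ : IsChartAt ψ (f x))
    (hφ' : IsChartAt φ' x) (hψ' : IsChartAt ψ' (f x)) (hf : ContinuousAt f x)
    {α : ℝ} (hα : 0 < α) (hC : ENNReal.ofReal α < regularityIndex N N' f Jf φ' ψ' x) :
    ∃ κ > α, ∃ O ∈ 𝓝 x, ∀ T ∈ localHull J φ O, Function.Bijective T ∧
      ∀ v, κ * N.chartNorm φ x v ≤ N'.chartNorm ψ (f x) (T v) := by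
  obtain ⟨-, R₀, hR₀, hbij⟩ := hreg
  simp only [regularityIndex, lt_iSup_iff] at hC
  obtain ⟨R₁, hR₁, hlt⟩ := hC
  obtain ⟨κ₁, hκ₁0, hκ₁, hκ₁'⟩ := ENNReal.lt_iff_exists_real_btwn.1 hlt
  have hακ : α < κ₁ := (ENNReal.ofReal_lt_ofReal_iff_of_nonneg hα.le).1 hκ₁
  obtain ⟨m, hm, M, hM, hmM⟩ := N.exists_chartNorm_bounds hφ
  obtain ⟨m', hm', M', hM', hmM'⟩ := N'.exists_chartNorm_bounds hψ
  have hκ₁pos : 0 < κ₁ := hα.trans hακ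
  -- This tolerance costs `(κ₁ - α) / 2` in the expansion factor and leaves `(κ₁ + α) / 2 > α`.
  obtain ⟨O, hO, hmem⟩ := exists_mem_coJacobian_of_mem_localHull N hrep hφ hψ hφ' hψ' hf
    (lt_min hR₀ hR₁) (show 0 < (κ₁ - α) / 2 * m / M' by
      have := sub_pos.2 hακ
      positivity)
  have hε : M' * ((κ₁ - α) / 2 * m / M') = (κ₁ - α) / 2 * m := by field_simp
  refine ⟨(κ₁ + α) / 2, by linarith, O, hO, fun T hT => ?_⟩
  obtain ⟨S, hS, hST⟩ := hmem T hT
  have hSb := hbij S (coJacobian_mono φ' ψ' x (min_le_left _ _) hS)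
  have hSC : ENNReal.ofReal κ₁ ≤ banachConstant (N.norm x) (N'.norm (f x)) S :=
    hκ₁'.le.trans (iInf₂_le S (coJacobian_mono φ' ψ' x (min_le_right _ _) hS))
  obtain ⟨e, rfl⟩ := exists_continuousLinearEquiv_of_bijective hφ hψ hSb
  have hlow := forall_le_of_ofReal_le_banachConstant (N.continuous_norm_apply x)
    (N'.exists_abs_le_mul_norm (f x)) e hκ₁pos hSC
  have hlow' : ∀ v, κ₁ * N.chartNorm φ x v ≤
      N'.chartNorm ψ (f x) (chartRep φ ψ x (f x) (e : _ →L[ℝ] _) v) := by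
    intro v
    have h1 := hlow (chartDerivSymm φ x v)
    rwa [N'.norm_eq_chartNorm hψ] at h1
  have := bijective_and_forall_le_of_norm_sub_le ((chartRep_bijective_iff hφ hψ _).2 hSb)
    (N.chartNorm φ x) (N'.chartNorm ψ (f x)) hm hM' hκ₁pos (fun v => (hmM v).1)
    (fun w => (hmM' w).2) hlow' ((norm_sub_rev _ _).trans_le hST)
    (by rw [hε]; exact mul_lt_mul_of_pos_right (by linarith) hm)
  rw [hε, mul_div_assoc, div_self hm.ne', mul_one] at this
  refine ⟨this.1, fun v => le_trans (le_of_eq ?_) (this.2 v)⟩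
  ring

/-- Equality of the two indices at a point where the operators of `co J` are isomorphisms which
expand by a factor `κ > α`. -/
theorem injectivityIndex_eq_regularityIndex [RegularSpace X] [PreconnectedSpace X]
    {φ φ' : OpenPartialHomeomorph X E} {ψ ψ' : OpenPartialHomeomorph Y F}
    {J : E → Set (E →L[ℝ] F)} {u : X} (hrep : IsRepresentedBy f Jf φ ψ J)
    (hφ : IsChartAt φ u) (hψ : IsChartAt ψ (f u))
    (hφ' : IsChartAt φ' u) (hψ' : IsChartAt ψ' (f u)) (hf : ContinuousAt f u)
    {α κ : ℝ} (hα : 0 < α) (hκ : α < κ) {O : Set X} (hO : O ∈ 𝓝 u)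
    (hT : ∀ T ∈ localHull J φ O, Function.Bijective T ∧
      ∀ v, κ * N.chartNorm φ u v ≤ N'.chartNorm ψ (f u) (T v)) :
    injectivityIndex N N' f Jf φ' ψ' u = regularityIndex N N' f Jf φ' ψ' u ∧
      ENNReal.ofReal α ≤ regularityIndex N N' f Jf φ' ψ' u := by
  obtain ⟨m, hm, M, hM, hmM⟩ := N.exists_chartNorm_bounds hφ
  obtain ⟨m', hm', M', hM', hmM'⟩ := N'.exists_chartNorm_bounds hψ
  -- This tolerance costs exactly `κ - α`, so the operators of the hull still expand by `α`.
  obtain ⟨R, hR, hmem⟩ := exists_mem_localHull_of_mem_coJacobian N hrep hφ hψ hφ' hψ' hf hO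
    (show 0 < (κ - α) * m / M' by
      have := sub_pos.2 hκ
      positivity)
  have hε : M' * ((κ - α) * m / M') = (κ - α) * m := by field_simp
  have key : ∀ S ∈ coJacobian N f Jf φ' ψ' u R,
      banachConstant (N.norm u) (N'.norm (f u)) S =
        dualBanachConstant (N.norm u) (N'.norm (f u)) S ∧
      ENNReal.ofReal α ≤ dualBanachConstant (N.norm u) (N'.norm (f u)) S := by
    intro S hS
    obtain ⟨T, hTmem, hST⟩ := hmem S hS
    obtain ⟨hTb, hTlow⟩ := hT T hTmem
    have := bijective_and_forall_le_of_norm_sub_le hTb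
      (N.chartNorm φ u) (N'.chartNorm ψ (f u)) hm hM' (hα.trans hκ) (fun v => (hmM v).1)
      (fun w => (hmM' w).2) hTlow hST
      (by rw [hε]; exact mul_lt_mul_of_pos_right (by linarith) hm)
    rw [hε, mul_div_assoc, div_self hm.ne', mul_one, sub_sub_cancel] at this
    obtain ⟨e, rfl⟩ := exists_continuousLinearEquiv_of_bijective hφ hψ
      ((chartRep_bijective_iff hφ hψ _).1 this.1)
    refine ⟨banachConstant_eq_dualBanachConstant (N.continuous_norm_apply u)
      (N'.exists_abs_le_mul_norm (f u)) e, ofReal_le_dualBanachConstant_iff.2 fun v => ?_⟩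
    rw [N.norm_eq_chartNorm hφ, N'.norm_eq_chartNorm hψ]
    refine (this.2 _).trans (le_of_eq ?_)
    change N'.chartNorm ψ (f u) (chartDeriv ψ (f u) (e (chartDerivSymm φ u (chartDeriv φ u v)))) = _
    rw [hφ.chartDerivSymm_chartDeriv]
    rfl
  -- The hulls shrink with the radius, so only radii at most `R` matter; there the constants agree
  -- operator by operator.
  have hstep : ∀ c : (TangentSpace 𝓘(ℝ, E) u →L[ℝ] TangentSpace 𝓘(ℝ, F) (f u)) → ℝ≥0∞,
      (⨆ (R' : ℝ) (_ : 0 < R'), ⨅ T ∈ coJacobian N f Jf φ' ψ' u R', c T) =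
        ⨆ (R' : ℝ) (_ : 0 < R'), ⨅ T ∈ coJacobian N f Jf φ' ψ' u (min R' R), c T := by
    intro c
    refine le_antisymm (iSup₂_mono fun R' _ => ?_) (iSup₂_le fun R' hR' => ?_)
    · exact biInf_mono (coJacobian_mono φ' ψ' u (min_le_left _ _))
    · exact le_iSup₂_of_le (min R' R) (lt_min hR' hR) le_rfl
  constructor
  · rw [injectivityIndex, regularityIndex, hstep, hstep]
    refine iSup_congr fun R' => iSup_congr fun _ => iInf_congr fun S => iInf_congr fun hS => ?_
    exact (key S (coJacobian_mono φ' ψ' u (min_le_right _ _) hS)).1.symm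
  · refine le_iSup₂_of_le R hR (le_iInf₂ fun S hS => ?_)
    rw [(key S hS).1]
    exact (key S hS).2

end Regularity

/-! ### Dimension zero, choice of the distortion factor, and small neighbourhoods -/

theorem subsingleton_of_chartedSpace (E X : Type*) [TopologicalSpace E] [Subsingleton E]
    [TopologicalSpace X] [ChartedSpace E X] [PreconnectedSpace X] : Subsingleton X := by
  have hdisc : DiscreteTopology X := by
    refine discreteTopology_iff_isOpen_singleton.2 fun x => ?_
    have h : (chartAt E x).source = {x} := eq_singleton_iff_unique_mem.2
      ⟨mem_chart_source E x, fun y hy =>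
        (chartAt E x).injOn hy (mem_chart_source E x) (Subsingleton.elim _ _)⟩
    exact h ▸ (chartAt E x).open_source
  exact PreconnectedSpace.trivial_of_discrete

/-- The two factors `k` pay for the distortion on `X` and on `Y`. -/
theorem exists_one_lt_mul_sq_lt {α κ : ℝ} (hα : 0 < α) (h : α < κ) :
    ∃ k : ℝ, 1 < k ∧ α * k ^ 2 < κ := by
  obtain ⟨s, hs1, hs2⟩ := exists_between ((one_lt_div hα).2 h)
  refine ⟨√s, by rwa [Real.lt_sqrt zero_le_one, one_pow], ?_⟩
  rw [Real.sq_sqrt (by linarith)]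
  rwa [lt_div_iff₀' hα] at hs2

namespace FinslerStructure

variable {E : Type*} [NormedAddCommGroup E] [NormedSpace ℝ E]
  {X : Type*} [TopologicalSpace X] [ChartedSpace E X] [IsManifold 𝓘(ℝ, E) 1 X]
  (N : FinslerStructure E X)

variable {N} in
theorem HasSmoothNorm.differentiableAt_chartNorm (hN : N.HasSmoothNorm)
    {φ : OpenPartialHomeomorph X E} {u : X} (hφ : IsChartAt φ u) {v : E} (hv : v ≠ 0) :
    DifferentiableAt ℝ (N.chartNorm φ u) v := by
  have h1 := hN u (chartDerivSymm φ u v) fun h => hv (by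
    have h2 := hφ.chartDeriv_chartDerivSymm v
    have h3 : chartDerivSymm φ u v = 0 := h
    rw [h3, map_zero] at h2
    exact h2.symm)
  exact h1.comp v (chartDerivSymm φ u : E →L[ℝ] E).differentiableAt

/-- Each point of a manifold of positive dimension has arbitrarily small neighbourhoods that do not
contain a ball of large radius. -/
theorem exists_nhds_forall_ball_subset_imp_le [Nontrivial E] [RegularSpace X]
    [PreconnectedSpace X] {u : X} {O : Set X} (hO : O ∈ 𝓝 u) {η : ℝ} (hη : 0 < η) :
    ∃ W ∈ 𝓝 u, W ⊆ O ∧ ∀ w ∈ W, ∀ r, N.ball w r ⊆ W → r ≤ η := by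
  set φ := chartAt E u
  have hφ : IsChartAt φ u := ⟨IsManifold.chart_mem_maximalAtlas u, mem_chart_source E u⟩
  obtain ⟨r₀, hr₀, h1, h2, -⟩ := N.exists_dist_comparison hφ one_lt_two hO
  obtain ⟨m, hm, M, hM, hmM⟩ := N.exists_chartNorm_bounds hφ
  set p := N.chartNorm φ u
  obtain ⟨v, hv⟩ := exists_ne (0 : E)
  have hpv : 0 < p v := (mul_pos hm (norm_pos_iff.2 hv)).trans_le (hmM v).1
  set s := min (r₀ / 2) (η / 4)
  have hs : 0 < s := by positivity
  have hsr : s < r₀ := (min_le_left _ _).trans_lt (by linarith)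
  have hsη : s ≤ η / 4 := min_le_right _ _
  refine ⟨φ.source ∩ φ ⁻¹' {z | p (z - φ u) < s}, inter_mem (φ.open_source.mem_nhds hφ.2)
    ((φ.continuousAt hφ.2).preimage_mem_nhds (N.pball_mem_nhds hφ _ hs)), ?_, ?_⟩
  · rintro w ⟨hw, hws⟩
    have hws : p (φ w - φ u) < s := hws
    have := (h1 (φ w) (hws.trans hsr)).2
    rwa [φ.left_inv hw] at this
  · rintro w ⟨hw, hws⟩ r hr
    have hws : p (φ w - φ u) < s := hws
    by_contra! hlt
    -- A point on the boundary of the chart ball: it lies outside `W`, yet within `4 s ≤ η` of every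
    -- `w ∈ W`, so a ball of radius above `η` would contain it.
    set e := φ u + (s / p v) • v with he
    have hpe : p (e - φ u) = s := by
      rw [he, add_sub_cancel_left, map_smul_eq_mul, Real.norm_of_nonneg (by positivity),
        div_mul_cancel₀ _ hpv.ne']
    have het := (h1 e (hpe ▸ hsr)).1
    have hd := (h2 e (φ w) (hpe ▸ hsr) (hws.trans hsr)).1
    rw [φ.left_inv hw] at hd
    have h3 : p (e - φ w) < 2 * s := by
      have := map_sub_le_add p (e - φ u) (φ w - φ u)
      rw [sub_sub_sub_cancel_right] at this
      linarith
    have h4 : φ.symm e ∈ N.ball w r := by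
      change N.dist (φ.symm e) w < r
      linarith
    have h5 : p (φ (φ.symm e) - φ u) < s := (hr h4).2
    rw [φ.right_inv het, hpe] at h5
    exact lt_irrefl _ h5

end FinslerStructure

/-! ### The local inverse -/

section LocalInverse

variable {E F : Type*} [NormedAddCommGroup E] [NormedSpace ℝ E]
  [NormedAddCommGroup F] [NormedSpace ℝ F]
  {X : Type*} [TopologicalSpace X] [RegularSpace X] [PreconnectedSpace X]
  [ChartedSpace E X] [IsManifold 𝓘(ℝ, E) 1 X]
  {Y : Type*} [TopologicalSpace Y] [ChartedSpace F Y] [IsManifold 𝓘(ℝ, F) 1 Y]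

/-- Pseudo-Jacobians are nonempty, so the hull contains an operator, and this operator maps `E` onto
`F`. -/
theorem IsJacobianRegularAt.subsingleton {N : FinslerStructure E X} {N' : FinslerStructure F Y}
    {f : X → Y} (hf : Continuous f) {Jf : OperatorFamily E F f}
    (hJf : IsStrongPseudoJacobianMapping f Jf)
    {x : X} {φ : OpenPartialHomeomorph X E} {ψ : OpenPartialHomeomorph Y F}
    (hφ : IsChartAt φ x) (hψ : IsChartAt ψ (f x))
    (hreg : IsJacobianRegularAt N N' f Jf φ ψ x) (hE : Subsingleton E) : Subsingleton F := by
  obtain ⟨-, R, hR, hbij⟩ := hreg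
  obtain ⟨φ₀, ψ₀, J, hφ₀, hψ₀, hrep, -⟩ := hJf x
  obtain ⟨O, hO, hmem⟩ := exists_mem_coJacobian_of_mem_localHull N hrep hφ₀ hψ₀ hφ hψ
    hf.continuousAt hR one_pos
  obtain ⟨T, hT⟩ := (hrep.2.1 _ (φ₀.map_source hφ₀.2)).1
  obtain ⟨S, hS, -⟩ := hmem T (subset_convexHull ℝ _ (mem_iUnion₂.2 ⟨x, mem_of_mem_nhds hO, hT⟩))
  have hsurj := ((chartRep_bijective_iff hφ₀ hψ₀ S).2 (hbij S hS)).2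
  exact hsurj.subsingleton

variable [RegularSpace Y] [PreconnectedSpace Y]

/-- The rate is `α` itself. If `W` is small, balls inside it have small radius, so `B_Y(f(w); α r)`
lies in `f(U)`; expansion then places the preimages in `B_X(w; r)`. -/
theorem isOpenWithLinearRateAt_of_expanding
    (N : FinslerStructure E X) (N' : FinslerStructure F Y) {f : X → Y} (hf : Continuous f)
    {U : Set X} {α : ℝ} (hα : 0 < α)
    (hexp : ∀ u ∈ U, ∀ u' ∈ U, α * N.dist u u' ≤ N'.dist (f u) (f u'))
    {u : X} (hU : U ∈ 𝓝 u) (hfU : f '' U ∈ 𝓝 (f u)) (hF : Subsingleton E → Subsingleton F) :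
    IsOpenWithLinearRateAt N N' f U u := by
  rcases subsingleton_or_nontrivial E with hE | hE
  -- In dimension zero `X` is a point and contains balls of every radius, so the radius cannot be
  -- bounded; but then `Y` is a point too.
  · have := hF hE
    have := subsingleton_of_chartedSpace F Y
    refine ⟨U, hU, subset_rfl, 1, one_pos, fun w _ r hr _ y _ => ⟨w, ?_, Subsingleton.elim _ _⟩⟩
    change N.dist w w < r
    rwa [N.dist_self]
  obtain ⟨δ, hδ, hball⟩ := N'.exists_ball_subset hfU
  obtain ⟨W, hW, hWU, hWr⟩ := N.exists_nhds_forall_ball_subset_imp_le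
    (inter_mem hU (hf.continuousAt.preimage_mem_nhds (N'.ball_mem_nhds (f u) (half_pos hδ))))
    (show 0 < δ / 2 / α by positivity)
  refine ⟨W, hW, fun w hw => (hWU hw).1, α, hα, fun w hw r hr hr' y hy => ?_⟩
  have h1 := hWr w hw r hr'
  rw [le_div_iff₀' hα] at h1
  have h2 : N'.dist (f w) (f u) < δ / 2 := (hWU hw).2
  have hy : N'.dist y (f w) < α * r := hy
  obtain ⟨a, ha, rfl⟩ := hball (show N'.dist y (f u) < δ by
    linarith [N'.dist_triangle y (f w) (f u)])
  exact ⟨a, lt_of_mul_lt_mul_left ((hexp a ha w (hWU hw).1).trans_lt hy) hα.le, rfl⟩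

/-- The local form of the inverse mapping theorem: near a regular point, `f` is injective, expands
distances by the factor `α`, is open, and has equal indices, bounded below by `α`. -/
theorem exists_isOpen_expanding_open [CompleteSpace E] [CompleteSpace F]
    (N : FinslerStructure E X) (N' : FinslerStructure F Y) (hN' : N'.HasSmoothNorm)
    {f : X → Y} (hf : IsLocallyLipschitz (E := E) (F := F) f)
    {Jf : OperatorFamily E F f} (hJf : IsStrongPseudoJacobianMapping f Jf)
    {x : X} {φ : OpenPartialHomeomorph X E} {ψ : OpenPartialHomeomorph Y F}
    (hφ : IsChartAt φ x) (hψ : IsChartAt ψ (f x))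
    (hreg : IsJacobianRegularAt N N' f Jf φ ψ x)
    {α : ℝ} (hα : 0 < α) (hC : ENNReal.ofReal α < regularityIndex N N' f Jf φ ψ x) :
    ∃ U : Set X, IsOpen U ∧ x ∈ U ∧ InjOn f U ∧
      (∀ u ∈ U, ∀ u' ∈ U, α * N.dist u u' ≤ N'.dist (f u) (f u')) ∧
      (∀ u ∈ U, ∀ V ∈ 𝓝 u, f '' V ∈ 𝓝 (f u)) ∧
      ∀ u ∈ U, ∀ (φ' : OpenPartialHomeomorph X E) (ψ' : OpenPartialHomeomorph Y F),
        IsChartAt φ' u → IsChartAt ψ' (f u) →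
          injectivityIndex N N' f Jf φ' ψ' u = regularityIndex N N' f Jf φ' ψ' u ∧
          ENNReal.ofReal α ≤ regularityIndex N N' f Jf φ' ψ' u := by
  have hfc := hf.continuous
  obtain ⟨φ₀, ψ₀, J, hφ₀, hψ₀, hrep, hstrong⟩ := hJf x
  obtain ⟨κ, hακ, O, hO, hT⟩ := hreg.exists_localHull hrep hφ₀ hψ₀ hφ hψ hfc.continuousAt hα hC
  obtain ⟨k, hk, hακk⟩ := exists_one_lt_mul_sq_lt hα hακ
  have hk0 : 0 < k := by linarith
  have hκ0 : 0 < κ := hα.trans hακ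
  obtain ⟨O₁, hO₁, hO₁φ, hclose⟩ := N.exists_nhds_chartNorm_le hφ₀ hk
  obtain ⟨O₂, hO₂, -, hclose'⟩ := N'.exists_nhds_chartNorm_le hψ₀ hk
  set O₃ := interior (O ∩ O₁ ∩ f ⁻¹' O₂)
  have hO₃ : O₃ ∈ 𝓝 x := interior_mem_nhds.2
    (inter_mem (inter_mem hO hO₁) (hfc.continuousAt.preimage_mem_nhds hO₂))
  have hO₃O : O₃ ⊆ O ∩ O₁ ∩ f ⁻¹' O₂ := interior_subset
  set p := N.chartNorm φ₀ x
  set q := N'.chartNorm ψ₀ (f x)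
  have hT₃ : ∀ T ∈ localHull J φ₀ O₃, Function.Bijective T ∧ ∀ v, κ * p v ≤ q (T v) :=
    fun T h => hT T (localHull_mono J φ₀ (fun u hu => (hO₃O hu).1.1) h)
  obtain ⟨r', hr', -, hYdist, -⟩ := N'.exists_dist_comparison hψ₀ hk univ_mem
  obtain ⟨L, s, hs, hL⟩ := hf.exists_lipschitzOnWith hφ₀ hψ₀
  set f₀ := ψ₀ ∘ f ∘ φ₀.symm with hf₀
  have hf₀φ : ∀ u ∈ φ₀.source, f₀ (φ₀ u) = ψ₀ (f u) := fun u hu => by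
    simp [hf₀, φ₀.left_inv hu]
  -- A neighbourhood on which the operators are controlled, `f₀` is Lipschitz, and the values of `f`
  -- stay where distances in `Y` compare with the chart.
  have hG : O₃ ∩ (f ⁻¹' (ψ₀ ⁻¹' {z | q (z - ψ₀ (f x)) < r'}) ∩ φ₀ ⁻¹' s) ∈ 𝓝 x := by
    refine inter_mem hO₃ (inter_mem (hfc.continuousAt.preimage_mem_nhds
      ((ψ₀.continuousAt hψ₀.2).preimage_mem_nhds (N'.pball_mem_nhds hψ₀ _ hr')))
      ((φ₀.continuousAt hφ₀.2).preimage_mem_nhds hs))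
  obtain ⟨r, hr, hXmem, hXdist, -⟩ := N.exists_dist_comparison hφ₀ hk hG
  have htarget : ∀ z, p (z - φ₀ x) < r → z ∈ φ₀.target := fun z hz => (hXmem z hz).1
  have hzO₃ : ∀ z, p (z - φ₀ x) < r → φ₀.symm z ∈ O₃ := fun z hz => (hXmem z hz).2.1
  have hzs : ∀ z, p (z - φ₀ x) < r → z ∈ s := fun z hz => by
    have := (hXmem z hz).2.2.2
    rwa [mem_preimage, φ₀.right_inv (htarget z hz)] at this
  have hzq : ∀ z, p (z - φ₀ x) < r → q (f₀ z - ψ₀ (f x)) < r' := fun z hz => (hXmem z hz).2.2.1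
  have hJhull : ∀ z, p (z - φ₀ x) < r → J z ⊆ localHull J φ₀ O₃ := fun z hz T hT => by
    refine subset_convexHull ℝ _ (mem_iUnion₂.2 ⟨φ₀.symm z, hzO₃ z hz, ?_⟩)
    rwa [φ₀.right_inv (htarget z hz)]
  have hexp : ∀ a b, p (a - φ₀ x) < r → p (b - φ₀ x) < r → κ * p (b - a) ≤ q (f₀ b - f₀ a) := by
    intro a b ha hb
    have hseg : ∀ z ∈ segment ℝ a b, p (z - φ₀ x) < r := fun z hz => by
      have := (p.convex_ball (φ₀ x) r).segment_subset ((p.mem_ball).2 ha) ((p.mem_ball).2 hb) hz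
      exact (p.mem_ball).1 this
    exact le_seminorm_sub_of_isPseudoJacobianAt
      (hL.continuousOn.mono fun z hz => hzs z (hseg z hz))
      (fun z hz => hrep.2.1 z (htarget z (hseg z hz))) (convex_convexHull ℝ _)
      (fun z hz => hJhull z (hseg z hz)) p q (N'.continuous_chartNorm hψ₀)
      fun T hT => (hT₃ T hT).2 _
  obtain ⟨m, hm, M, hM, hmM⟩ := N.exists_chartNorm_bounds hφ₀
  obtain ⟨m', hm', M', hM', hmM'⟩ := N'.exists_chartNorm_bounds hψ₀
  have hpball : IsOpen {z | p (z - φ₀ x) < r} :=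
    isOpen_lt ((N.continuous_chartNorm hφ₀).comp (by fun_prop : Continuous fun z => z - φ₀ x))
      continuous_const
  refine ⟨φ₀.source ∩ φ₀ ⁻¹' {z | p (z - φ₀ x) < r}, φ₀.isOpen_inter_preimage hpball,
    ⟨hφ₀.2, by simpa using hr⟩, ?_, ?_, ?_, ?_⟩
  · rintro u ⟨hu, hur⟩ u' ⟨hu', hur'⟩ heq
    have h1 := hexp _ _ hur hur'
    rw [hf₀φ u hu, hf₀φ u' hu', heq, sub_self, map_zero] at h1
    have h2 := (hmM (φ₀ u' - φ₀ u)).1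
    have h3 : p (φ₀ u' - φ₀ u) ≤ 0 := by
      by_contra! h
      nlinarith
    have h4 : ‖φ₀ u' - φ₀ u‖ ≤ 0 := by
      by_contra! h
      nlinarith
    exact (φ₀.injOn hu' hu (sub_eq_zero.1 (norm_le_zero_iff.1 h4))).symm
  · rintro u ⟨hu, hur⟩ u' ⟨hu', hur'⟩
    have h1 := hexp _ _ hur' hur
    have h2 := (hXdist _ _ hur hur').1
    have h3 := (hYdist _ _ (hzq _ hur) (hzq _ hur')).2
    rw [φ₀.left_inv hu, φ₀.left_inv hu'] at h2
    rw [hf₀φ u hu, hf₀φ u' hu', ψ₀.left_inv (hrep.1 hu), ψ₀.left_inv (hrep.1 hu')] at h3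
    rw [hf₀φ u hu, hf₀φ u' hu'] at h1
    -- One `k` comes from bounding `d_X` by the chart norm, the other from bounding the chart norm
    -- by `d_Y`.
    have h4 : k * (α * (k * p (φ₀ u - φ₀ u'))) ≤ k * N'.dist (f u) (f u') := by
      have h5 : α * k ^ 2 * p (φ₀ u - φ₀ u') ≤ κ * p (φ₀ u - φ₀ u') :=
        mul_le_mul_of_nonneg_right hακk.le (apply_nonneg p _)
      calc _ = α * k ^ 2 * p (φ₀ u - φ₀ u') := by ring
        _ ≤ _ := h5.trans (h1.trans h3)
    calc α * N.dist u u' ≤ α * (k * p (φ₀ u - φ₀ u')) := by gcongr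
      _ ≤ _ := le_of_mul_le_mul_left h4 hk0
  · rintro u ⟨hu, hur⟩ V hV
    have hut := φ₀.map_source hu
    have hV' : {z | p (z - φ₀ x) < r} ∩ φ₀.symm ⁻¹' V ∈ 𝓝 (φ₀ u) := by
      refine inter_mem (hpball.mem_nhds hur) ((φ₀.continuousAt_symm hut).preimage_mem_nhds ?_)
      rwa [φ₀.left_inv hu]
    obtain ⟨R, hR, hball⟩ := Metric.nhds_basis_closedBall.mem_iff.1 hV'
    have hball' : ∀ z ∈ Metric.ball (φ₀ u) R, p (z - φ₀ x) < r := fun z hz =>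
      (hball (Metric.ball_subset_closedBall hz)).1
    obtain ⟨δ, hδ, himage⟩ := exists_ball_subset_image hR
      (hL.mono fun z hz => hzs z (hball hz).1) (J := J)
      (fun z hz => ⟨hrep.2.1 z (htarget z (hball' z hz)), hstrong z (htarget z (hball' z hz))⟩)
      -- The expansion factor `κ` restated for the norms of `E` and `F`.
      (c := κ * m / M') (by positivity)
      (fun z hz T hT => by
        obtain ⟨h1, h2⟩ := hT₃ T (hJhull z (hball' z hz) hT)
        refine ⟨h1.2, fun v => ?_⟩
        rw [div_mul_eq_mul_div, div_le_iff₀' hM']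
        calc κ * m * ‖v‖ = κ * (m * ‖v‖) := by ring
          _ ≤ κ * p v := by
            gcongr
            exact (hmM v).1
          _ ≤ _ := (h2 v).trans (hmM' _).2)
      q hm' hM' (fun w => (hmM' w).1) (fun w => (hmM' w).2)
      fun w hw => hN'.differentiableAt_chartNorm hψ₀ hw
    have hfu := hrep.1 hu
    filter_upwards [ψ₀.open_source.mem_nhds hfu,
      (ψ₀.continuousAt hfu).preimage_mem_nhds (by
        rw [← hf₀φ u hu]
        exact Metric.ball_mem_nhds _ hδ)] with y hy hyδ
    obtain ⟨a, ha, hay⟩ := himage hyδ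
    have hat := htarget a (hball' a ha)
    exact ⟨φ₀.symm a, (hball (Metric.ball_subset_closedBall ha)).2,
      ψ₀.injOn (hrep.1 (φ₀.map_target hat)) hy hay⟩
  · rintro u ⟨hu, hur⟩ φ' ψ' hφ' hψ'
    have huO₃ : u ∈ O₃ := by
      have := hzO₃ _ hur
      rwa [φ₀.left_inv hu] at this
    -- Replacing the norms at `x` and `f x` by those at `u` and `f u` costs a factor `k` on each
    -- side.
    have hακ' : α < κ / k ^ 2 := by rwa [lt_div_iff₀ (by positivity)]
    refine injectivityIndex_eq_regularityIndex hrep (hφ₀.of_mem hu) (hψ₀.of_mem (hrep.1 hu)) hφ' hψ'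
      hfc.continuousAt hα hακ' (isOpen_interior.mem_nhds huO₃) fun T hT => ?_
    obtain ⟨h1, h2⟩ := hT₃ T hT
    refine ⟨h1, fun v => ?_⟩
    have h3 := (hclose u (hO₃O huO₃).1.2 v).2
    have h4 := (hclose' (f u) (hO₃O huO₃).2 (T v)).1
    rw [div_mul_eq_mul_div, div_le_iff₀' (by positivity)]
    calc κ * N.chartNorm φ₀ u v ≤ κ * (k * p v) := by gcongr
      _ = k * (κ * p v) := by ring
      _ ≤ k * (k * N'.chartNorm ψ₀ (f u) (T v)) := by
        exact mul_le_mul_of_nonneg_left ((h2 v).trans h4) hk0.le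
      _ = _ := by ring

end LocalInverse

end

/-! ### The inverse mapping theorem -/

theorem theorem5p4
    {E F : Type*} [NormedAddCommGroup E] [NormedSpace ℝ E] [CompleteSpace E]
    [NormedAddCommGroup F] [NormedSpace ℝ F] [CompleteSpace F]
    {X : Type*} [TopologicalSpace X] [T3Space X] [ConnectedSpace X]
    [ChartedSpace E X] [IsManifold 𝓘(ℝ, E) 1 X]
    {Y : Type*} [TopologicalSpace Y] [T3Space Y] [ConnectedSpace Y]
    [ChartedSpace F Y] [IsManifold 𝓘(ℝ, F) 1 Y]
    (N : FinslerStructure E X) (N' : FinslerStructure F Y) (hN' : N'.HasSmoothNorm)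
    (f : X → Y) (hf : IsLocallyLipschitz (E := E) (F := F) f)
    (Jf : OperatorFamily E F f) (hJf : IsStrongPseudoJacobianMapping f Jf)
    (x : X) (φ : OpenPartialHomeomorph X E) (ψ : OpenPartialHomeomorph Y F)
    (hφ : IsChartAt φ x) (hψ : IsChartAt ψ (f x))
    (hreg : IsJacobianRegularAt N N' f Jf φ ψ x)
    (α : ℝ) (hα : 0 < α) (hC : ENNReal.ofReal α < regularityIndex N N' f Jf φ ψ x) :
    ∃ (U : Set X) (fx : U ≃ₜ (f '' U)), IsOpen U ∧ x ∈ U ∧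
      -- homeomorphism onto the image, expanding distances
      (∀ u : U, (fx u : Y) = f u) ∧
      (∀ u ∈ U, ∀ u' ∈ U, α * N.dist u u' ≤ N'.dist (f u) (f u')) ∧
      -- openness with linear rate, and the two indices
      IsOpenMap (fun u : U => f u) ∧
      (∀ u ∈ U, IsOpenWithLinearRateAt N N' f U u) ∧
      (∀ u ∈ U, ∀ (φ' : OpenPartialHomeomorph X E) (ψ' : OpenPartialHomeomorph Y F),
        IsChartAt φ' u → IsChartAt ψ' (f u) →
          injectivityIndex N N' f Jf φ' ψ' u = regularityIndex N N' f Jf φ' ψ' u ∧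
          ENNReal.ofReal α ≤ regularityIndex N N' f Jf φ' ψ' u) ∧
      -- Lipschitz continuity of the inverse
      (∃ K : ℝ, ∀ y y' : (f '' U), N.dist (fx.symm y) (fx.symm y') ≤ K * N'.dist y y') ∧
      (∀ u ∈ U, lipRate N N' (fun y : (f '' U) => (fx.symm y : X)) (f u) ≤
        (ENNReal.ofReal α)⁻¹) := by
  have hfc := hf.continuous
  obtain ⟨U, hU, hxU, hinj, hexp, hopen, hindex⟩ :=
    exists_isOpen_expanding_open N N' hN' hf hJf hφ hψ hreg hα hC
  have hmap : IsOpenMap fun u : U => f u := by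
    refine IsOpenMap.of_nhds_le fun u s hs => ?_
    have hs' : f ⁻¹' s ∈ 𝓝 (u : X) := by
      rw [← hU.isOpenEmbedding_subtypeVal.map_nhds_eq]
      exact hs
    exact mem_of_superset (hopen u u.2 _ hs') (image_preimage_subset f s)
  have hmap' : IsOpenMap (Equiv.Set.imageOfInjOn f U hinj) := fun V hV =>
    ⟨_, hmap V hV, by
      ext y
      constructor
      · rintro ⟨u, hu, huy⟩
        exact ⟨u, hu, Subtype.ext huy⟩
      · rintro ⟨u, hu, rfl⟩
        exact ⟨u, hu, rfl⟩⟩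
  set fx : U ≃ₜ (f '' U) := (Equiv.Set.imageOfInjOn f U hinj).toHomeomorphOfContinuousOpen
    (Continuous.subtype_mk (hfc.comp continuous_subtype_val) _) hmap'
  have hfx : ∀ u : U, (fx u : Y) = f u := fun u => rfl
  have hinv : ∀ y y' : f '' U, N.dist (fx.symm y) (fx.symm y') ≤ α⁻¹ * N'.dist y y' := by
    intro y y'
    have h := hexp _ (fx.symm y).2 _ (fx.symm y').2
    rw [← hfx, ← hfx, fx.apply_symm_apply, fx.apply_symm_apply] at h
    rwa [le_inv_mul_iff₀ hα]
  refine ⟨U, fx, hU, hxU, hfx, hexp, hmap, fun u hu => ?_, hindex, ⟨α⁻¹, hinv⟩, fun u hu => ?_⟩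
  · exact isOpenWithLinearRateAt_of_expanding N N' hfc hα hexp (hU.mem_nhds hu)
      (hopen u hu U (hU.mem_nhds hu)) (hreg.subsingleton hfc hJf hφ hψ)
  -- The bound for the inverse holds on all of `f(U)`, so any radius will do.
  · refine iInf₂_le_of_le 1 one_pos (iSup_le fun z => iSup_le fun z' => iSup_le fun _ => ?_)
    rw [← ENNReal.ofReal_inv_of_pos hα]
    exact ENNReal.ofReal_le_ofReal
      (div_le_of_le_mul₀ (N'.dist_nonneg _ _) (inv_nonneg.2 hα.le) (hinv z z'))
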